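/- Let $n\ge 1$, let $\vec p=(p_1,\dots,p_n)$ with $0<p_j<\infty$ for every $j$, and let $0<t<\min(p_1,\dots,p_n)$. For a measurable function $g$ on $\mathbb R^n$ (with values in $\mathbb C$ or in $[0,\infty]$) put $$\|g\|_{\vec p}=\left(\int_{\mathbb R}\cdots\left(\int_{\mathbb R}\left(\int_{\mathbb R}|g(x_1,x_2,\dots,x_n)|^{p_1}\,dx_1\right)^{\frac{p_2}{p_1}}dx_2\right)^{\frac{p_3}{p_2}}\cdots dx_n\right)^{\frac1{p_n}},$$ and let $L^{\vec p}(\mathbb R^n)$ be the set of measurable $f:\mathbb R^n\to\mathbb C$ with $\|f\|_{\vec p}<\infty$. For $1\le k\le n$ let $$M_kg(x)=\sup_{I\ni x_k}\frac1{|I|}\int_I|g(x_1,\dots,x_{k-1},y_k,x_{k+1},\dots,x_n)|\,dy_k,$$ where $I$ ranges over the bounded nondegenerate intervals of $\mathbb R$ containing $x_k$, and let $$\mathcal M_tf(x)=\big(M_n\cdots M_1[|f|^t](x)\big)^{1/t}.$$ Then there is a constant $C>0$, depending only on $n$, $\vec p$ and $t$, such that for every $f\in L^{\vec p}(\mathbb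 R^n)$ the function $\mathcal M_tf:\mathbb R^n\to[0,\infty]$ is measurable and $$\|\mathcal M_tf\|_{\vec p}\le C\,\|f\|_{\vec p}.$$ -/

import Mathlib

open MeasureTheory
open scoped ENNReal NNReal

noncomputable section

/-- The mixed Lebesgue norm of a `[0, ∞]`-valued function on `ℝⁿ`, for finite exponents: the
integration in `x₁` is innermost, the one in `xₙ` is outermost.  For `n = 0` it is the value of the
function at the only point. -/
def mixedNorm : {n : ℕ} → (Fin n → ℝ) → ((Fin n → ℝ) → ℝ≥0∞) → ℝ≥0∞
  | 0, _, F => F Fin.elim0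
  | n + 1, p, F =>
      (∫⁻ s : ℝ, mixedNorm (fun j : Fin n => p j.castSucc)
          (fun y : Fin n → ℝ => F (Fin.snoc (α := fun _ => ℝ) y s)) ^ p (Fin.last n))
        ^ (1 / p (Fin.last n))

/-- The mixed Lebesgue space: the (Lebesgue) measurable functions `f : ℝⁿ → ℂ` whose mixed norm is
finite.  `AEMeasurable f volume` says that `f` is Lebesgue measurable. -/
def mixedLebesgue {n : ℕ} (p : Fin n → ℝ) : Set ((Fin n → ℝ) → ℂ) :=
  {f | AEMeasurable f volume ∧ mixedNorm p (fun x => ‖f x‖ₑ) < ∞}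

/-- The one-dimensional uncentered maximal operator in the `k`-th variable.  Since points are null
sets, the supremum over the closed bounded intervals `[a, b] ∋ x k` with `a < b` is the supremum over
all bounded nondegenerate intervals containing `x k`. -/
def directionalMaximal {n : ℕ} (k : Fin n) (F : (Fin n → ℝ) → ℝ≥0∞) (x : Fin n → ℝ) : ℝ≥0∞ :=
  ⨆ (a : ℝ) (b : ℝ) (_ : a < b) (_ : x k ∈ Set.Icc a b),
    (∫⁻ s in Set.Icc a b, F (Function.update x k s)) / ENNReal.ofReal (b - a)

/-- The composition `Mₙ ⋯ M₁ F` (the operator in the first variable is applied first). -/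
def composedMaximal {n : ℕ} (F : (Fin n → ℝ) → ℝ≥0∞) : (Fin n → ℝ) → ℝ≥0∞ :=
  Fin.foldl n (fun G k => directionalMaximal k G) F

/-- The iterated maximal operator `(Mₙ ⋯ M₁ [|f| ^ t]) ^ (1 / t)`. -/
def iteratedMaximal {n : ℕ} (t : ℝ) (f : (Fin n → ℝ) → ℂ) (x : Fin n → ℝ) : ℝ≥0∞ :=
  composedMaximal (fun y => ‖f y‖ₑ ^ t) x ^ (1 / t)

end

open MeasureTheory
open scoped ENNReal NNReal

/-! ### Maximal functions on the line with respect to a measure -/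

/-! Raising to the power `t` turns the claim into the boundedness of Mₙ⋯M₁ on the mixed space with
exponents q_j = p_j / t > 1. This goes by induction on the number of variables: the operators in the
earlier variables act slice by slice, so what remains is the operator in the last variable, a
one-dimensional maximal operator acting on functions with values in a mixed Lebesgue space.

That vector-valued inequality, `exists_weightedBound_mixedNorm`, is proved by a second induction, on
the number of variables of the value space, for all exponents r > 1 and all A_r weights in the
variable of the maximal operator. When r is the outermost exponent b of the value space, Tonelli
pulls out the corresponding integral and leaves the same inequality with one variable fewer.
Extrapolation, `exists_weightedBound_of_weightedBound`, then passes from b to any r. Weights serve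
only to permit this change of exponent; at the end the weight is 1.

The scalar input is the weighted maximal theorem `exists_ratMaximal_weighted`. On the line, the
maximal operator of an arbitrary s-finite measure is bounded on L^p with a constant independent of
the measure, because finite families of intervals can be thinned to overlap at most 2. Lerner's
pointwise estimate dominates the Lebesgue maximal function by those of w and of its dual weight, at
the cost of the A_p constant alone.

Extrapolation majorizes g in L^p(w), and the dual function f^(p-1) w in the dual space, by A_1
weights U and V. Since f ≤ U + f^p₀ U^(1-p₀) and V U^(1-p₀) is an A_p₀ weight, the hypothesis at p₀
bounds ∫ f V by ∫ U V, and Hölder finishes. The cases p < p₀ and p > p₀ need no separate treatment.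
-/

/-- Among finitely many intervals of the line one can keep some that have the same union and of
which no three have a common point. -/
theorem exists_subfamily_overlap_le_two {ι : Type*} [DecidableEq ι] (a b : ι → ℝ) (S : Finset ι) :
    ∃ T ⊆ S, (⋃ i ∈ S, Set.Icc (a i) (b i)) ⊆ ⋃ i ∈ T, Set.Icc (a i) (b i) ∧
      ∀ x, (T.filter fun i => x ∈ Set.Icc (a i) (b i)).card ≤ 2 := by
  induction hn : S.card generalizing S with
  | zero =>
    obtain rfl := Finset.card_eq_zero.1 hn
    exact ⟨∅, subset_rfl, subset_rfl, by simp⟩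
  | succ n ih =>
    by_cases h : ∀ x, (S.filter fun i => x ∈ Set.Icc (a i) (b i)).card ≤ 2
    · exact ⟨S, subset_rfl, subset_rfl, h⟩
    push Not at h
    obtain ⟨x, hx⟩ := h
    set R := S.filter fun i => x ∈ Set.Icc (a i) (b i) with hR
    have hne : R.Nonempty := Finset.card_pos.1 (by omega)
    obtain ⟨i, hi, hmin⟩ := Finset.exists_min_image R a hne
    obtain ⟨j, hj, hmax⟩ := Finset.exists_max_image R b hne
    obtain ⟨k, hk, hkij⟩ : ∃ k ∈ R, k ∉ ({i, j} : Finset ι) := by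
      refine Finset.exists_mem_notMem_of_card_lt_card ?_
      exact lt_of_le_of_lt Finset.card_le_two hx
    simp only [Finset.mem_insert, Finset.mem_singleton, not_or] at hkij
    have mem : ∀ l ∈ R, l ∈ S ∧ a l ≤ x ∧ x ≤ b l := fun l hl => by
      simpa [hR] using hl
    obtain ⟨T, hTS, hT, hcard⟩ := ih (S.erase k) (by
      rw [Finset.card_erase_of_mem (mem k hk).1, hn]; simp)
    refine ⟨T, hTS.trans (Finset.erase_subset _ _), subset_trans ?_ hT, hcard⟩
    intro y hy
    simp only [Set.mem_iUnion, Finset.mem_erase, exists_prop] at hy ⊢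
    obtain ⟨l, hl, hyl⟩ := hy
    by_cases hlk : l = k
    · subst hlk
      rcases le_total y x with hyx | hyx
      · exact ⟨i, ⟨Ne.symm hkij.1, (mem i hi).1⟩, (hmin l hk).trans hyl.1,
          hyx.trans (mem i hi).2.2⟩
      · exact ⟨j, ⟨Ne.symm hkij.2, (mem j hj).1⟩, (mem j hj).2.1.trans hyx,
          hyl.2.trans (hmax l hk)⟩
    · exact ⟨l, ⟨hlk, hl⟩, hyl⟩

/-- The uncentered maximal function of `f` with respect to `μ`, over the closed intervals with
rational endpoints. -/
noncomputable def ratMaximal (μ : Measure ℝ) (f : ℝ → ℝ≥0∞) (x : ℝ) : ℝ≥0∞ :=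
  ⨆ q : ℚ × ℚ, (Set.Icc (q.1 : ℝ) q.2).indicator
    (fun _ => (∫⁻ y in Set.Icc (q.1 : ℝ) q.2, f y ∂μ) / μ (Set.Icc (q.1 : ℝ) q.2)) x

theorem measurable_ratMaximal (μ : Measure ℝ) (f : ℝ → ℝ≥0∞) : Measurable (ratMaximal μ f) :=
  .iSup fun _ => measurable_const.indicator measurableSet_Icc

theorem average_le_ratMaximal (μ : Measure ℝ) (f : ℝ → ℝ≥0∞) (q : ℚ × ℚ) {x : ℝ}
    (hx : x ∈ Set.Icc (q.1 : ℝ) q.2) :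
    (∫⁻ y in Set.Icc (q.1 : ℝ) q.2, f y ∂μ) / μ (Set.Icc (q.1 : ℝ) q.2) ≤ ratMaximal μ f x := by
  refine le_trans ?_ (le_iSup _ q)
  rw [Set.indicator_of_mem hx]

theorem ratMaximal_le_iff {μ : Measure ℝ} {f : ℝ → ℝ≥0∞} {x : ℝ} {c : ℝ≥0∞} :
    ratMaximal μ f x ≤ c ↔ ∀ q : ℚ × ℚ, x ∈ Set.Icc (q.1 : ℝ) q.2 →
      (∫⁻ y in Set.Icc (q.1 : ℝ) q.2, f y ∂μ) / μ (Set.Icc (q.1 : ℝ) q.2) ≤ c := by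
  refine ⟨fun h q hx => (average_le_ratMaximal μ f q hx).trans h, fun h => iSup_le fun q => ?_⟩
  by_cases hx : x ∈ Set.Icc (q.1 : ℝ) q.2
  · rw [Set.indicator_of_mem hx]; exact h q hx
  · rw [Set.indicator_of_notMem hx]; exact zero_le

/-- Rational endpoints make the family of intervals countable, so the measure of the level set is
controlled by finite subfamilies. Thinning these to overlap at most 2 gives the constant 2 with no
doubling assumption on `μ`. -/
theorem ratMaximal_weak_type (μ : Measure ℝ) {f : ℝ → ℝ≥0∞} (hf : Measurable f) (c : ℝ≥0∞) :
    c * μ {x | c < ratMaximal μ f x} ≤ 2 * ∫⁻ x, f x ∂μ := by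
  let I : ℚ × ℚ → Set ℝ := fun q => Set.Icc (q.1 : ℝ) q.2
  let B : Set (ℚ × ℚ) := {q | c < (∫⁻ y in I q, f y ∂μ) / μ (I q)}
  have hset : {x | c < ratMaximal μ f x} ⊆ ⋃ S : Finset B, ⋃ q ∈ S, I q := by
    intro x hx
    obtain ⟨q, hq⟩ := lt_iSup_iff.1 (show c < ratMaximal μ f x from hx)
    by_cases hxq : x ∈ Set.Icc (q.1 : ℝ) q.2
    · rw [Set.indicator_of_mem hxq] at hq
      simp only [Set.mem_iUnion]
      exact ⟨{⟨q, hq⟩}, ⟨q, hq⟩, by simp, hxq⟩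
    · rw [Set.indicator_of_notMem hxq] at hq
      exact absurd hq not_lt_zero
  have hdir : Directed (· ⊆ ·) fun S : Finset B => ⋃ q ∈ S, I q := by
    intro S T
    classical
    refine ⟨S ∪ T, ?_, ?_⟩
    · exact Set.biUnion_subset_biUnion_left fun q hq => Finset.mem_union_left _ hq
    · exact Set.biUnion_subset_biUnion_left fun q hq => Finset.mem_union_right _ hq
  refine (mul_le_mul_right (measure_mono hset) c).trans ?_
  rw [hdir.measure_iUnion, ENNReal.mul_iSup]
  refine iSup_le fun S => ?_
  classical
  obtain ⟨T, -, hT, hcard⟩ := exists_subfamily_overlap_le_two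
    (fun q : B => (q.1.1 : ℝ)) (fun q : B => (q.1.2 : ℝ)) S
  calc c * μ (⋃ q ∈ S, I q) ≤ c * ∑ q ∈ T, μ (I q) := by
        gcongr
        exact (measure_mono hT).trans (measure_biUnion_finset_le _ _)
    _ = ∑ q ∈ T, c * μ (I q) := Finset.mul_sum _ _ _
    _ ≤ ∑ q ∈ T, ∫⁻ y in I q, f y ∂μ := by
        refine Finset.sum_le_sum fun q _ => ?_
        exact ENNReal.mul_le_of_le_div (le_of_lt q.2)
    _ = ∑ q ∈ T, ∫⁻ y, (I q).indicator f y ∂μ := by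
        simp_rw [lintegral_indicator (show MeasurableSet (I _) from measurableSet_Icc)]
    _ = ∫⁻ y, ∑ q ∈ T, (I q).indicator f y ∂μ := by
        rw [lintegral_finsetSum]
        exact fun q _ => hf.indicator measurableSet_Icc
    _ ≤ ∫⁻ y, 2 * f y ∂μ := by
        refine lintegral_mono fun y => ?_
        simp only [Set.indicator_apply]
        rw [← Finset.sum_filter, Finset.sum_const, nsmul_eq_mul]
        gcongr
        exact_mod_cast hcard y
    _ = 2 * ∫⁻ x, f x ∂μ := lintegral_const_mul _ hf

theorem ratMaximal_le_add (μ : Measure ℝ) {f g : ℝ → ℝ≥0∞} {c : ℝ≥0∞} (hg : Measurable g)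
    (h : ∀ x, f x ≤ g x + c) (x : ℝ) : ratMaximal μ f x ≤ ratMaximal μ g x + c := by
  refine ratMaximal_le_iff.2 fun q hx => ?_
  calc (∫⁻ y in Set.Icc (q.1 : ℝ) q.2, f y ∂μ) / μ (Set.Icc (q.1 : ℝ) q.2)
      ≤ (∫⁻ y in Set.Icc (q.1 : ℝ) q.2, (g y + c) ∂μ) / μ (Set.Icc (q.1 : ℝ) q.2) := by
        gcongr with y; exact h y
    _ = (∫⁻ y in Set.Icc (q.1 : ℝ) q.2, g y ∂μ) / μ (Set.Icc (q.1 : ℝ) q.2)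
        + c * (μ (Set.Icc (q.1 : ℝ) q.2) / μ (Set.Icc (q.1 : ℝ) q.2)) := by
        rw [lintegral_add_left hg, ENNReal.add_div, setLIntegral_const, mul_div_assoc]
    _ ≤ ratMaximal μ g x + c := by
        gcongr
        · exact average_le_ratMaximal μ g q hx
        · exact mul_le_of_le_one_right' ENNReal.div_self_le_one

/-- The part of `f` below l / 2 raises the maximal function by at most l / 2, so only the part above
l / 2 matters, at level l / 2. -/
theorem ratMaximal_weak_type_truncated (μ : Measure ℝ) {f : ℝ → ℝ≥0∞} (hf : Measurable f) (l : ℝ) :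
    ENNReal.ofReal l * μ {x | ENNReal.ofReal l < ratMaximal μ f x} ≤
      4 * ∫⁻ x, {x | ENNReal.ofReal l < 2 * f x}.indicator f x ∂μ := by
  have hm : MeasurableSet {x | ENNReal.ofReal l < 2 * f x} :=
    measurableSet_lt measurable_const (hf.const_mul 2)
  set g := {x | ENNReal.ofReal l < 2 * f x}.indicator f with hg
  have hgm : Measurable g := hf.indicator hm
  have h2 : (2 : ℝ≥0∞) * ENNReal.ofReal (l / 2) = ENNReal.ofReal l := by
    rw [← ENNReal.ofReal_ofNat, ← ENNReal.ofReal_mul (by norm_num)]; congr 1; ring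
  have hle : ∀ x, f x ≤ g x + ENNReal.ofReal (l / 2) := by
    intro x
    by_cases hx : ENNReal.ofReal l < 2 * f x
    · rw [hg, Set.indicator_of_mem (by exact hx)]; exact le_self_add
    · rw [not_lt, ← h2] at hx
      exact le_add_left ((ENNReal.mul_le_mul_iff_right (by norm_num) (by norm_num)).1 hx)
  have hsub : {x | ENNReal.ofReal l < ratMaximal μ f x} ⊆
      {x | ENNReal.ofReal (l / 2) < ratMaximal μ g x} := by
    intro x hx
    by_contra hcon
    simp only [Set.mem_ofPred_eq, not_lt] at hx hcon
    refine absurd (hx.trans_le ((ratMaximal_le_add μ hgm hle x).trans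
      (add_le_add_left hcon _))) ?_
    rw [← two_mul, h2]; exact lt_irrefl _
  calc ENNReal.ofReal l * μ {x | ENNReal.ofReal l < ratMaximal μ f x}
      ≤ ENNReal.ofReal l * μ {x | ENNReal.ofReal (l / 2) < ratMaximal μ g x} := by gcongr
    _ = 2 * (ENNReal.ofReal (l / 2) * μ {x | ENNReal.ofReal (l / 2) < ratMaximal μ g x}) := by
        rw [← h2, mul_assoc]
    _ ≤ 2 * (2 * ∫⁻ x, g x ∂μ) := by
        exact mul_le_mul_right (ratMaximal_weak_type μ hgm _) 2
    _ = _ := by rw [← mul_assoc]; norm_num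

/-- The layer-cake formula for a single value, read off from a Dirac mass when `c` is finite and by
monotonicity when `c = ∞`. Maximal functions may take the value ∞, so that case is needed. -/
theorem ofReal_mul_lintegral_rpow_eq (c : ℝ≥0∞) {q : ℝ} (hq : 0 < q) :
    ENNReal.ofReal q * ∫⁻ l in Set.Ioi (0 : ℝ),
      {l : ℝ | ENNReal.ofReal l < c}.indicator (fun l => ENNReal.ofReal (l ^ (q - 1))) l = c ^ q := by
  have hfin : ∀ r : ℝ, 0 ≤ r → ENNReal.ofReal q * ∫⁻ l in Set.Ioi (0 : ℝ),
      {l : ℝ | ENNReal.ofReal l < ENNReal.ofReal r}.indicator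
        (fun l => ENNReal.ofReal (l ^ (q - 1))) l = ENNReal.ofReal r ^ q := by
    intro r hr
    have h := lintegral_rpow_eq_lintegral_meas_lt_mul (Measure.dirac (0 : ℝ)) (f := fun _ => r)
      (Filter.Eventually.of_forall fun _ => hr) aemeasurable_const hq
    rw [lintegral_dirac, ENNReal.ofReal_rpow_of_nonneg hr hq.le |>.symm] at h
    rw [h]
    congr 1
    refine setLIntegral_congr_fun measurableSet_Ioi fun l hl => ?_
    by_cases hlr : l < r
    · rw [Set.indicator_of_mem]
      · simp [hlr]
      · exact (ENNReal.ofReal_lt_ofReal_iff_of_nonneg (le_of_lt hl)).2 hlr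
    · rw [Set.indicator_of_notMem]
      · simp [hlr]
      · exact fun h => hlr ((ENNReal.ofReal_lt_ofReal_iff_of_nonneg (le_of_lt hl)).1 h)
  by_cases hc : c = ∞
  · subst hc
    rw [ENNReal.top_rpow_of_pos hq, eq_top_iff]
    refine ENNReal.le_of_forall_nnreal_lt fun r _ => ?_
    have h := hfin ((r : ℝ) ^ (1 / q)) (by positivity)
    rw [ENNReal.ofReal_rpow_of_nonneg (by positivity) hq.le, ← Real.rpow_mul r.coe_nonneg,
      one_div_mul_cancel hq.ne', Real.rpow_one, ENNReal.ofReal_coe_nnreal] at h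
    rw [← h]
    refine mul_le_mul_right (lintegral_mono fun l => ?_) _
    simp only [Set.indicator_apply]
    split_ifs with h₁ h₂
    · exact le_rfl
    · exact absurd ENNReal.ofReal_lt_top h₂
    · exact zero_le
    · exact le_rfl
  · rw [← ENNReal.ofReal_toReal hc]
    exact hfin _ ENNReal.toReal_nonneg

/-- Integrate the one-value formula and apply Tonelli. The factor `g` allows two uses: `g = 1` for
the maximal function, and `g = f` with exponent p - 1 to resum the truncated weak-type bounds. -/
theorem lintegral_rpow_eq_lintegral_distribution (μ : Measure ℝ) [SFinite μ] {f g : ℝ → ℝ≥0∞}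
    (hf : Measurable f) (hg : Measurable g) {q : ℝ} (hq : 0 < q) :
    ∫⁻ x, g x * f x ^ q ∂μ = ENNReal.ofReal q * ∫⁻ l in Set.Ioi (0 : ℝ),
      ENNReal.ofReal (l ^ (q - 1)) * ∫⁻ x, {x | ENNReal.ofReal l < f x}.indicator g x ∂μ := by
  have hmeas : Measurable (fun z : ℝ × ℝ => g z.1 * {z : ℝ × ℝ | ENNReal.ofReal z.2 < f z.1}.indicator
      (fun z => ENNReal.ofReal (z.2 ^ (q - 1))) z) := by
    refine (hg.comp measurable_fst).mul (Measurable.indicator ?_ ?_)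
    · exact (measurable_snd.pow_const _).ennreal_ofReal
    · exact measurableSet_lt measurable_snd.ennreal_ofReal (hf.comp measurable_fst)
  have hind : ∀ x, Measurable fun l : ℝ =>
      {l : ℝ | ENNReal.ofReal l < f x}.indicator (fun l => ENNReal.ofReal (l ^ (q - 1))) l :=
    fun x => (measurable_id.pow_const _).ennreal_ofReal.indicator
      (measurableSet_lt measurable_id.ennreal_ofReal measurable_const)
  calc ∫⁻ x, g x * f x ^ q ∂μ
      = ∫⁻ x, ENNReal.ofReal q * (∫⁻ l in Set.Ioi (0 : ℝ), g x *
          {l : ℝ | ENNReal.ofReal l < f x}.indicator (fun l => ENNReal.ofReal (l ^ (q - 1))) l) ∂μ := by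
        refine lintegral_congr fun x => ?_
        rw [lintegral_const_mul _ (hind x), mul_left_comm, ofReal_mul_lintegral_rpow_eq _ hq]
    _ = ENNReal.ofReal q * ∫⁻ x, (∫⁻ l in Set.Ioi (0 : ℝ), g x *
          {l : ℝ | ENNReal.ofReal l < f x}.indicator (fun l => ENNReal.ofReal (l ^ (q - 1))) l) ∂μ := by
        rw [lintegral_const_mul' _ _ ENNReal.ofReal_ne_top]
    _ = ENNReal.ofReal q * ∫⁻ l in Set.Ioi (0 : ℝ), ∫⁻ x, g x * {l : ℝ | ENNReal.ofReal l < f x}.indicator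
          (fun l => ENNReal.ofReal (l ^ (q - 1))) l ∂μ := by
        rw [lintegral_lintegral_swap]
        exact hmeas.aemeasurable
    _ = _ := by
        congr 1
        refine lintegral_congr fun l => ?_
        rw [← lintegral_const_mul' _ _ ENNReal.ofReal_ne_top]
        refine lintegral_congr fun x => ?_
        by_cases h : ENNReal.ofReal l < f x <;> simp [h, mul_comm]

/-- The maximal operator with respect to `μ` is bounded on `L^p(μ)` for `p > 1`, with a constant that
does not depend on `μ`. -/
theorem exists_ratMaximal_strong_type {p : ℝ} (hp : 1 < p) :
    ∃ C : ℝ≥0, ∀ (μ : Measure ℝ) [SFinite μ] (f : ℝ → ℝ≥0∞), Measurable f →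
      ∫⁻ x, ratMaximal μ f x ^ p ∂μ ≤ C * ∫⁻ x, f x ^ p ∂μ := by
  have hp1 : 0 < p - 1 := by linarith
  have hp0 : 0 < p := by linarith
  refine ⟨Real.toNNReal p * 4 * (Real.toNNReal (p - 1))⁻¹ * (2 : ℝ≥0) ^ (p - 1), ?_⟩
  intro μ _ f hf
  have h1 := lintegral_rpow_eq_lintegral_distribution μ (measurable_ratMaximal μ f)
    (g := fun _ => 1) measurable_const hp0
  have h2 := lintegral_rpow_eq_lintegral_distribution μ (hf.const_mul 2) hf hp1
  simp only [one_mul] at h1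
  have h3 : ∫⁻ l in Set.Ioi (0 : ℝ), ENNReal.ofReal (l ^ (p - 1)) *
        ∫⁻ x, {x | ENNReal.ofReal l < ratMaximal μ f x}.indicator (fun _ => 1) x ∂μ ≤
      4 * ∫⁻ l in Set.Ioi (0 : ℝ), ENNReal.ofReal (l ^ (p - 1 - 1)) *
        ∫⁻ x, {x | ENNReal.ofReal l < 2 * f x}.indicator f x ∂μ := by
    rw [← lintegral_const_mul' _ _ (by norm_num)]
    refine setLIntegral_mono' measurableSet_Ioi fun l hl => ?_
    have hl' : 0 < l := hl
    rw [lintegral_indicator (measurableSet_lt measurable_const (measurable_ratMaximal μ f)),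
      setLIntegral_one, show l ^ (p - 1) = l ^ (p - 1 - 1) * l by
        rw [← Real.rpow_add_one hl'.ne']; congr 1; ring,
      ENNReal.ofReal_mul (by positivity), mul_assoc]
    rw [mul_left_comm 4]
    exact mul_le_mul_right (ratMaximal_weak_type_truncated μ hf l) _
  have hpe : ENNReal.ofReal (p - 1) ≠ 0 := by simpa using hp
  rw [h1]
  refine (mul_le_mul_right h3 _).trans (le_of_eq ?_)
  have h4 : ∫⁻ l in Set.Ioi (0 : ℝ), ENNReal.ofReal (l ^ (p - 1 - 1)) *
        ∫⁻ x, {x | ENNReal.ofReal l < 2 * f x}.indicator f x ∂μ =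
      (ENNReal.ofReal (p - 1))⁻¹ * (2 ^ (p - 1) * ∫⁻ x, f x ^ p ∂μ) := by
    have h5 : ∫⁻ x, f x * (2 * f x) ^ (p - 1) ∂μ = 2 ^ (p - 1) * ∫⁻ x, f x ^ p ∂μ := by
      rw [← lintegral_const_mul _ (hf.pow_const p)]
      refine lintegral_congr fun x => ?_
      rw [ENNReal.mul_rpow_of_nonneg _ _ hp1.le, mul_left_comm]
      nth_rewrite 1 [← ENNReal.rpow_one (f x)]
      rw [← ENNReal.rpow_add_of_nonneg _ _ zero_le_one hp1.le, add_sub_cancel]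
    rw [← h5, h2, ← mul_assoc, ENNReal.inv_mul_cancel hpe ENNReal.ofReal_ne_top, one_mul]
  rw [h4]
  push_cast
  rw [ENNReal.coe_inv (by simpa using hp), ENNReal.coe_rpow_of_nonneg _ hp1.le]
  simp only [ENNReal.ofReal]
  push_cast
  ring

/-! ### Muckenhoupt weights on the line -/

/-- `w` is an `A_p` weight on the line whose `A_p` constant is at most `K`. -/
structure IsApWeight (p : ℝ) (K : ℝ≥0) (w : ℝ → ℝ≥0∞) : Prop where
  measurable : Measurable w
  ae_ne_zero : ∀ᵐ x, w x ≠ 0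
  ae_ne_top : ∀ᵐ x, w x ≠ ∞
  bound : ∀ a b : ℝ, a < b →
    (∫⁻ x in Set.Icc a b, w x) * (∫⁻ x in Set.Icc a b, w x ^ (-(1 / (p - 1)))) ^ (p - 1) ≤
      K * ENNReal.ofReal (b - a) ^ p

theorem setLIntegral_Icc_ne_zero {u : ℝ → ℝ≥0∞} (hu : Measurable u) (h0 : ∀ᵐ x, u x ≠ 0) {a b : ℝ}
    (hab : a < b) : ∫⁻ x in Set.Icc a b, u x ≠ 0 := by
  intro h
  rw [lintegral_eq_zero_iff hu] at h
  have h' : ∀ᵐ x ∂(volume.restrict (Set.Icc a b)), False := by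
    filter_upwards [h, ae_restrict_of_ae h0] with x hx hx'
    exact hx' hx
  rw [ae_iff] at h'
  simp at h'
  linarith

namespace IsApWeight

variable {p : ℝ} {K : ℝ≥0} {w : ℝ → ℝ≥0∞}

theorem measurable_dual (hw : IsApWeight p K w) :
    Measurable fun x => w x ^ (-(1 / (p - 1))) := hw.measurable.pow_const _

theorem ae_dual_ne_zero (hp : 1 < p) (hw : IsApWeight p K w) :
    ∀ᵐ x, w x ^ (-(1 / (p - 1))) ≠ 0 := by
  have : 0 < 1 / (p - 1) := by rw [one_div_pos]; linarith
  filter_upwards [hw.ae_ne_top] with x hx h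
  rw [ENNReal.rpow_neg, ENNReal.inv_eq_zero, ENNReal.rpow_eq_top_iff_of_pos this] at h
  exact hx h

theorem ae_dual_ne_top (hp : 1 < p) (hw : IsApWeight p K w) :
    ∀ᵐ x, w x ^ (-(1 / (p - 1))) ≠ ∞ := by
  have : 0 < 1 / (p - 1) := by rw [one_div_pos]; linarith
  filter_upwards [hw.ae_ne_zero] with x hx h
  rw [ENNReal.rpow_neg, ENNReal.inv_eq_top, ENNReal.rpow_eq_zero_iff_of_pos this] at h
  exact hx h

theorem setLIntegral_ne_top (hp : 1 < p) (hw : IsApWeight p K w) {a b : ℝ} (hab : a < b) :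
    ∫⁻ x in Set.Icc a b, w x ≠ ∞ := by
  intro h
  have hb := hw.bound a b hab
  have h0 := setLIntegral_Icc_ne_zero hw.measurable_dual (hw.ae_dual_ne_zero hp) hab
  rw [h, ENNReal.top_mul] at hb
  · refine absurd (top_le_iff.1 hb) (ENNReal.mul_ne_top ENNReal.coe_ne_top ?_)
    exact ENNReal.rpow_ne_top_of_nonneg (by linarith) ENNReal.ofReal_ne_top
  · rw [Ne, ENNReal.rpow_eq_zero_iff_of_pos (by linarith)]
    exact h0

theorem setLIntegral_dual_ne_top (hp : 1 < p) (hw : IsApWeight p K w) {a b : ℝ} (hab : a < b) :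
    ∫⁻ x in Set.Icc a b, w x ^ (-(1 / (p - 1))) ≠ ∞ := by
  intro h
  have hb := hw.bound a b hab
  have h0 := setLIntegral_Icc_ne_zero hw.measurable hw.ae_ne_zero hab
  rw [h, ENNReal.top_rpow_of_pos (by linarith), ENNReal.mul_top h0] at hb
  refine absurd (top_le_iff.1 hb) (ENNReal.mul_ne_top ENNReal.coe_ne_top ?_)
  exact ENNReal.rpow_ne_top_of_nonneg (by linarith) ENNReal.ofReal_ne_top

theorem dual_rpow (hp : 1 < p) (c : ℝ≥0∞) : (c ^ (-(1 / (p - 1)))) ^ (1 - p) = c := by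
  have : p - 1 ≠ 0 := by linarith
  rw [← ENNReal.rpow_mul, show -(1 / (p - 1)) * (1 - p) = 1 by field_simp; ring, ENNReal.rpow_one]

/-- The dual weight of an `A_p` weight is a weight of the conjugate Muckenhoupt class. -/
theorem dual (hp : 1 < p) (hw : IsApWeight p K w) :
    IsApWeight (p / (p - 1)) (K ^ (1 / (p - 1))) fun x => w x ^ (-(1 / (p - 1))) where
  measurable := hw.measurable_dual
  ae_ne_zero := hw.ae_dual_ne_zero hp
  ae_ne_top := hw.ae_dual_ne_top hp
  bound a b hab := by
    have hp1 : 0 < p - 1 := by linarith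
    have e : p / (p - 1) - 1 = 1 / (p - 1) := by field_simp; ring
    have e2 : -(1 / (p - 1)) * -(1 / (1 / (p - 1))) = 1 := by field_simp
    have h := ENNReal.rpow_le_rpow (hw.bound a b hab) (one_div_pos.2 hp1).le
    simp only [e, ← ENNReal.rpow_mul, e2, ENNReal.rpow_one]
    rw [ENNReal.mul_rpow_of_nonneg _ _ (one_div_pos.2 hp1).le,
      ENNReal.mul_rpow_of_nonneg _ _ (one_div_pos.2 hp1).le, ← ENNReal.rpow_mul, ← ENNReal.rpow_mul,
      mul_one_div_cancel hp1.ne', ENNReal.rpow_one, mul_comm, mul_one_div,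
      ← ENNReal.coe_rpow_of_nonneg _ (one_div_pos.2 hp1).le] at h
    exact h

/-- The maximal function is controlled pointwise by maximal functions with respect to the weight
and to its dual weight. -/
theorem ratMaximal_rpow_le (hp : 1 < p) (hw : IsApWeight p K w) {f : ℝ → ℝ≥0∞}
    (hf : Measurable f) (x : ℝ) :
    ratMaximal volume f x ^ (p - 1) ≤ K * ratMaximal (volume.withDensity w) (fun z =>
      ratMaximal (volume.withDensity fun y => w y ^ (-(1 / (p - 1))))
        (fun y => f y / w y ^ (-(1 / (p - 1)))) z ^ (p - 1) / w z) x := by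
  have hp1 : 0 < p - 1 := by linarith
  set s : ℝ → ℝ≥0∞ := fun y => w y ^ (-(1 / (p - 1))) with hs
  have hsm : Measurable s := hw.measurable_dual
  have hfs : Measurable fun y => f y / s y := hf.div hsm
  set A := ratMaximal (volume.withDensity s) (fun y => f y / s y) with hA
  have hAm : Measurable A := measurable_ratMaximal _ _
  set B := ratMaximal (volume.withDensity w) (fun z => A z ^ (p - 1) / w z) with hB
  have hFm : Measurable fun z => A z ^ (p - 1) / w z := (hAm.pow_const _).div hw.measurable
  rw [← ENNReal.le_rpow_inv_iff hp1]
  refine ratMaximal_le_iff.2 fun q hx => ?_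
  set I := Set.Icc (q.1 : ℝ) q.2 with hI
  rcases (hx.1.trans hx.2).eq_or_lt with hq | hq
  · rw [hI, ← hq]; simp
  rw [ENNReal.le_rpow_inv_iff hp1]
  set J := ∫⁻ y in I, f y
  set m := ∫⁻ y in I, w y
  set v := ∫⁻ y in I, s y
  set d := ENNReal.ofReal (q.2 - q.1 : ℝ) with hd
  have hd0 : d ≠ 0 := by simpa [hd] using hq
  have hdt : d ≠ ∞ := ENNReal.ofReal_ne_top
  have hm0 : m ≠ 0 := setLIntegral_Icc_ne_zero hw.measurable hw.ae_ne_zero hq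
  have hmt : m ≠ ∞ := hw.setLIntegral_ne_top hp hq
  have hv0 : v ≠ 0 := setLIntegral_Icc_ne_zero hsm (hw.ae_dual_ne_zero hp) hq
  have hvt : v ≠ ∞ := hw.setLIntegral_dual_ne_top hp hq
  have hvol : volume I = d := Real.volume_Icc
  -- J / v is the average of f / s over `I` for the measure s dy, so it lies below `A` throughout
  -- `I`.
  have hAy : ∀ y ∈ I, J / v ≤ A y := by
    intro y hy
    have h := average_le_ratMaximal (volume.withDensity s) (fun y => f y / s y) q hy
    rw [← hI, withDensity_apply _ measurableSet_Icc,
      setLIntegral_withDensity_eq_setLIntegral_mul _ hsm hfs measurableSet_Icc] at h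
    refine le_trans (le_of_eq ?_) h
    congr 1
    refine lintegral_congr_ae (ae_restrict_of_ae ?_)
    filter_upwards [hw.ae_dual_ne_zero hp, hw.ae_dual_ne_top hp] with y h0 ht
    exact (ENNReal.mul_div_cancel h0 ht).symm
  have h1 : (J / v) ^ (p - 1) * d ≤ ∫⁻ y in I, A y ^ (p - 1) := by
    rw [← hvol, ← setLIntegral_const]
    exact setLIntegral_mono' measurableSet_Icc fun y hy =>
      ENNReal.rpow_le_rpow (hAy y hy) hp1.le
  -- The constant is integrated over `I` against dy = w⁻¹ · w dy, which makes a `w`-average of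
  -- A^(p-1) / w appear.
  have h2 : ∫⁻ y in I, A y ^ (p - 1) ≤ B x * m := by
    have h := average_le_ratMaximal (volume.withDensity w) (fun z => A z ^ (p - 1) / w z) q hx
    rw [← hI, withDensity_apply _ measurableSet_Icc,
      setLIntegral_withDensity_eq_setLIntegral_mul _ hw.measurable
        hFm measurableSet_Icc,
      ENNReal.div_le_iff hm0 hmt] at h
    refine le_trans (le_of_eq ?_) h
    refine lintegral_congr_ae (ae_restrict_of_ae ?_)
    filter_upwards [hw.ae_ne_zero, hw.ae_ne_top] with y h0 ht
    exact (ENNReal.mul_div_cancel h0 ht).symm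
  have hb : m * v ^ (p - 1) ≤ K * d ^ p := hw.bound _ _ hq
  rw [hvol, ENNReal.div_rpow_of_nonneg _ _ hp1.le, ENNReal.div_le_iff
    (by simpa [ENNReal.rpow_eq_zero_iff_of_pos hp1] using hd0)
    (ENNReal.rpow_ne_top_of_nonneg hp1.le hdt),
    ← ENNReal.mul_le_mul_iff_left hd0 hdt]
  calc J ^ (p - 1) * d = ((J / v) ^ (p - 1) * d) * v ^ (p - 1) := by
        rw [mul_right_comm, ← ENNReal.mul_rpow_of_nonneg _ _ hp1.le, ENNReal.div_mul_cancel hv0 hvt]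
    _ ≤ (B x * m) * v ^ (p - 1) := mul_le_mul_left (h1.trans h2) _
    _ = B x * (m * v ^ (p - 1)) := mul_assoc _ _ _
    _ ≤ B x * (K * d ^ p) := by gcongr
    _ = K * B x * d ^ (p - 1) * d := by
        rw [show d ^ p = d ^ (p - 1) * d by
          nth_rewrite 3 [← ENNReal.rpow_one d]
          rw [← ENNReal.rpow_add _ _ hd0 hdt, sub_add_cancel]]
        ring

end IsApWeight

/-- The maximal operator is bounded on `L^p(w)` for every `A_p` weight `w`. -/
theorem exists_ratMaximal_weighted {p : ℝ} (hp : 1 < p) (K : ℝ≥0) :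
    ∃ C : ℝ≥0, ∀ w, IsApWeight p K w → ∀ f : ℝ → ℝ≥0∞, Measurable f →
      ∫⁻ x, ratMaximal volume f x ^ p * w x ≤ C * ∫⁻ x, f x ^ p * w x := by
  have hp1 : 0 < p - 1 := by linarith
  have hp0 : 0 < p := by linarith
  have hp' : 1 < p / (p - 1) := by rw [lt_div_iff₀ hp1]; linarith
  have hp0' : 0 < p / (p - 1) := by linarith
  obtain ⟨C₁, hC₁⟩ := exists_ratMaximal_strong_type hp
  obtain ⟨C₂, hC₂⟩ := exists_ratMaximal_strong_type hp'
  refine ⟨K ^ (p / (p - 1)) * (C₂ * C₁), fun w hw f hf => ?_⟩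
  set s : ℝ → ℝ≥0∞ := fun y => w y ^ (-(1 / (p - 1))) with hs
  have hsm : Measurable s := hw.measurable_dual
  have hfs : Measurable fun y => f y / s y := hf.div hsm
  set A := ratMaximal (volume.withDensity s) (fun y => f y / s y) with hA
  have hAm : Measurable A := measurable_ratMaximal _ _
  set B := ratMaximal (volume.withDensity w) (fun z => A z ^ (p - 1) / w z) with hB
  have hBm : Measurable B := measurable_ratMaximal _ _
  have hFm : Measurable fun z => A z ^ (p - 1) / w z := (hAm.pow_const _).div hw.measurable
  calc ∫⁻ x, ratMaximal volume f x ^ p * w x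
      ≤ ∫⁻ x, K ^ (p / (p - 1)) * (w x * B x ^ (p / (p - 1))) := by
        refine lintegral_mono fun x => ?_
        have h := ENNReal.rpow_le_rpow (hw.ratMaximal_rpow_le hp hf x) hp0'.le
        rw [← ENNReal.rpow_mul, mul_div_cancel₀ _ hp1.ne', ENNReal.mul_rpow_of_nonneg _ _ hp0'.le] at h
        calc _ ≤ _ := mul_le_mul_left h (w x)
          _ = _ := by ring
    _ = K ^ (p / (p - 1)) * ∫⁻ x, B x ^ (p / (p - 1)) ∂(volume.withDensity w) := by
        have hwm := hw.measurable
        rw [lintegral_const_mul _ (by fun_prop),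
          lintegral_withDensity_eq_lintegral_mul _ hw.measurable (hBm.pow_const _)]
        rfl
    _ ≤ K ^ (p / (p - 1)) *
        (C₂ * ∫⁻ x, (A x ^ (p - 1) / w x) ^ (p / (p - 1)) ∂(volume.withDensity w)) := by
        gcongr
        exact hC₂ _ _ hFm
    _ = K ^ (p / (p - 1)) * (C₂ * ∫⁻ x, A x ^ p ∂(volume.withDensity s)) := by
        rw [lintegral_withDensity_eq_lintegral_mul _ hw.measurable (hFm.pow_const _),
          lintegral_withDensity_eq_lintegral_mul _ hsm (hAm.pow_const _)]
        -- With p' = p / (p - 1), the powers of the weight combine to w^(1-p') = w^(-1/(p-1)), the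
        -- dual weight.
        congr 2
        refine lintegral_congr_ae ?_
        filter_upwards [hw.ae_ne_zero, hw.ae_ne_top] with x h0 ht
        simp only [Pi.mul_apply, hs]
        rw [ENNReal.div_rpow_of_nonneg _ _ hp0'.le, ← ENNReal.rpow_mul, mul_div_cancel₀ _ hp1.ne',
          div_eq_mul_inv, ← ENNReal.rpow_neg, mul_left_comm, mul_comm]
        nth_rewrite 1 [← ENNReal.rpow_one (w x)]
        rw [← ENNReal.rpow_add _ _ h0 ht, show 1 + -(p / (p - 1)) = -(1 / (p - 1)) by
          field_simp; ring]
    _ ≤ K ^ (p / (p - 1)) * (C₂ * (C₁ * ∫⁻ x, (f x / s x) ^ p ∂(volume.withDensity s))) := by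
        gcongr
        exact hC₁ _ _ hfs
    _ = K ^ (p / (p - 1)) * (C₂ * (C₁ * ∫⁻ x, f x ^ p * w x)) := by
        rw [lintegral_withDensity_eq_lintegral_mul _ hsm (hfs.pow_const p)]
        congr 3
        refine lintegral_congr_ae ?_
        filter_upwards [hw.ae_dual_ne_zero hp, hw.ae_dual_ne_top hp] with x h0 ht
        simp only [Pi.mul_apply]
        have e : w x = s x ^ (1 - p) := (IsApWeight.dual_rpow hp (w x)).symm
        rw [ENNReal.div_rpow_of_nonneg _ _ hp0.le, div_eq_mul_inv, ← ENNReal.rpow_neg,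
          mul_left_comm, e]
        nth_rewrite 1 [← ENNReal.rpow_one (s x)]
        rw [← ENNReal.rpow_add _ _ h0 ht, ← sub_eq_add_neg]
    _ = _ := by
        rw [ENNReal.coe_mul, ENNReal.coe_mul, ENNReal.coe_rpow_of_nonneg _ hp0'.le]
        ring

/-! ### The Rubio de Francia algorithm and extrapolation -/

/-- Slightly larger rational intervals contain [a, b]; their lengths tend to b - a. -/
theorem setLIntegral_Icc_le_ratMaximal (f : ℝ → ℝ≥0∞) {a b x : ℝ} (hab : a < b)
    (hx : x ∈ Set.Icc a b) :
    ∫⁻ y in Set.Icc a b, f y ≤ ratMaximal volume f x * ENNReal.ofReal (b - a) := by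
  set m := ratMaximal volume f x with hm
  by_cases htop : m = ∞
  · rw [htop, ENNReal.top_mul (by simpa using hab)]; exact le_top
  have hbound : ∀ δ : ℝ, 0 < δ → ∫⁻ y in Set.Icc a b, f y ≤ m * ENNReal.ofReal (b - a + 2 * δ) := by
    intro δ hδ
    obtain ⟨q, hq1, hq2⟩ := exists_rat_btwn (show a - δ < a by linarith)
    obtain ⟨r, hr1, hr2⟩ := exists_rat_btwn (show b < b + δ by linarith)
    have h := average_le_ratMaximal volume f (q, r) (x := x)
      ⟨hq2.le.trans hx.1, hx.2.trans hr1.le⟩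
    simp only [Real.volume_Icc] at h
    rw [ENNReal.div_le_iff (by
      rw [Ne, ENNReal.ofReal_eq_zero]; linarith) ENNReal.ofReal_ne_top] at h
    calc ∫⁻ y in Set.Icc a b, f y ≤ ∫⁻ y in Set.Icc (q : ℝ) r, f y :=
          lintegral_mono_set (Set.Icc_subset_Icc hq2.le hr1.le)
      _ ≤ m * ENNReal.ofReal (r - q) := h
      _ ≤ _ := by gcongr; linarith
  have hlim : Filter.Tendsto (fun δ : ℝ => m * ENNReal.ofReal (b - a + 2 * δ))
      (nhdsWithin 0 (Set.Ioi 0)) (nhds (m * ENNReal.ofReal (b - a))) := by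
    refine ENNReal.Tendsto.const_mul ?_ (Or.inr htop)
    refine ENNReal.tendsto_ofReal ?_
    have : Continuous fun δ : ℝ => b - a + 2 * δ := by fun_prop
    have h := (this.tendsto 0).mono_left (nhdsWithin_le_nhds (s := Set.Ioi 0))
    simpa using h
  exact ge_of_tendsto hlim (Filter.eventually_of_mem self_mem_nhdsWithin hbound)

theorem ratMaximal_tsum_le (f : ℕ → ℝ → ℝ≥0∞) (hf : ∀ k, Measurable (f k)) (c : ℕ → ℝ≥0∞) (x : ℝ) :
    ratMaximal volume (fun y => ∑' k, c k * f k y) x ≤ ∑' k, c k * ratMaximal volume (f k) x := by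
  refine ratMaximal_le_iff.2 fun q hx => ?_
  rw [lintegral_tsum fun k => ((hf k).const_mul _).aemeasurable, div_eq_mul_inv,
    ← ENNReal.tsum_mul_right]
  refine ENNReal.tsum_le_tsum fun k => ?_
  rw [lintegral_const_mul _ (hf k), mul_assoc, ← div_eq_mul_inv]
  exact mul_le_mul_right (average_le_ratMaximal volume (f k) q hx) _

/-- If the maximal function vanishes at one point, `f` vanishes almost everywhere on every large
interval around it. This makes the Rubio de Francia majorant positive. -/
theorem ratMaximal_ne_zero {f : ℝ → ℝ≥0∞} (hf : Measurable f) (h0 : ¬ ∀ᵐ x, f x = 0) (x : ℝ) :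
    ratMaximal volume f x ≠ 0 := by
  intro h
  apply h0
  have hn : ∀ n : ℕ, |x| ≤ n → 0 < n → ∀ᵐ y, y ∈ Set.Icc (-(n : ℝ)) n → f y = 0 := by
    intro n hxn hn
    rw [← ae_restrict_iff' measurableSet_Icc]
    have hpos : (0 : ℝ) < n := by exact_mod_cast hn
    have h' := setLIntegral_Icc_le_ratMaximal f (a := -(n : ℝ)) (b := n) (by linarith) (abs_le.1 hxn)
    rw [h, zero_mul, nonpos_iff_eq_zero, lintegral_eq_zero_iff hf] at h'
    exact h'
  have hall : ∀ᵐ y, ∀ n : ℕ, |x| ≤ n → 0 < n → y ∈ Set.Icc (-(n : ℝ)) n → f y = 0 := by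
    rw [ae_all_iff]
    intro n
    by_cases h1 : |x| ≤ n
    · by_cases h2 : 0 < n
      · filter_upwards [hn n h1 h2] with y hy _ _ using hy
      · exact Filter.Eventually.of_forall fun y _ h => absurd h h2
    · exact Filter.Eventually.of_forall fun y h => absurd h h1
  filter_upwards [hall] with y hy
  obtain ⟨n, hn⟩ := exists_nat_ge (max (max |x| |y|) 1)
  refine hy n (le_trans (by simp) hn) ?_ (abs_le.1 (le_trans (by simp) hn))
  have : (1 : ℝ) ≤ n := le_trans (by simp) hn
  exact_mod_cast this

/-- `u` is an `A_1` weight on the line whose `A_1` constant is at most `K`. -/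
structure IsAOneWeight (K : ℝ≥0) (u : ℝ → ℝ≥0∞) : Prop where
  measurable : Measurable u
  ae_ne_zero : ∀ᵐ x, u x ≠ 0
  ae_ne_top : ∀ᵐ x, u x ≠ ∞
  bound : ∀ a b : ℝ, a < b → ∀ᵐ x, x ∈ Set.Icc a b →
    ∫⁻ y in Set.Icc a b, u y ≤ K * ENNReal.ofReal (b - a) * u x

/-- The bound `c` is the average of `u` divided by `K`. It is finite because the A_1 inequality
holds at some point of the interval where `u` is finite. -/
theorem IsAOneWeight.exists_lower_bound {K : ℝ≥0} {u : ℝ → ℝ≥0∞} (hu : IsAOneWeight K u) {a b : ℝ}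
    (hab : a < b) : ∃ c : ℝ≥0∞, c ≠ 0 ∧ c ≠ ∞ ∧
      ∫⁻ y in Set.Icc a b, u y = K * ENNReal.ofReal (b - a) * c ∧
      ∀ᵐ x, x ∈ Set.Icc a b → c ≤ u x := by
  set d := ENNReal.ofReal (b - a) with hd
  set m := ∫⁻ y in Set.Icc a b, u y with hm
  have hm0 : m ≠ 0 := setLIntegral_Icc_ne_zero hu.measurable hu.ae_ne_zero hab
  have hd0 : d ≠ 0 := by simpa [hd] using hab
  have hdt : d ≠ ∞ := ENNReal.ofReal_ne_top
  obtain ⟨x, hxI, hxb, hxt⟩ : ∃ x, x ∈ Set.Icc a b ∧ m ≤ K * d * u x ∧ u x ≠ ∞ := by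
    by_contra hcon
    push Not at hcon
    have : ∀ᵐ x ∂(volume.restrict (Set.Icc a b)), False := by
      filter_upwards [ae_restrict_of_ae (hu.bound a b hab), ae_restrict_of_ae hu.ae_ne_top,
        ae_restrict_mem measurableSet_Icc] with x h1 h2 h3
      exact h2 (hcon x h3 (h1 h3))
    rw [ae_iff] at this
    simp at this
    linarith
  have hK0 : (K : ℝ≥0∞) ≠ 0 := by
    intro h
    rw [h, zero_mul, zero_mul, nonpos_iff_eq_zero] at hxb
    exact hm0 hxb
  have hKd0 : (K : ℝ≥0∞) * d ≠ 0 := mul_ne_zero hK0 hd0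
  have hKdt : (K : ℝ≥0∞) * d ≠ ∞ := ENNReal.mul_ne_top ENNReal.coe_ne_top hdt
  have hmt : m ≠ ∞ := ne_top_of_le_ne_top (ENNReal.mul_ne_top hKdt hxt) hxb
  refine ⟨m / (K * d), ENNReal.div_ne_zero.2 ⟨hm0, hKdt⟩, ENNReal.div_ne_top hmt hKd0,
    (ENNReal.mul_div_cancel hKd0 hKdt).symm, ?_⟩
  filter_upwards [hu.bound a b hab] with y hy hyI
  exact ENNReal.div_le_of_le_mul' (hy hyI)

theorem ennreal_rpow_le_rpow_of_nonpos {r : ℝ} (hr : r ≤ 0) {a b : ℝ≥0∞} (h : a ≤ b) :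
    b ^ r ≤ a ^ r := by
  rw [← neg_neg r, ENNReal.rpow_neg _ (-r), ENNReal.rpow_neg _ (-r), ENNReal.inv_le_inv]
  exact ENNReal.rpow_le_rpow h (by linarith)

/-- The easy half of the factorization of `A_p` weights. -/
theorem IsAOneWeight.mul_rpow {p : ℝ} (hp : 1 < p) {K L : ℝ≥0} {u v : ℝ → ℝ≥0∞}
    (hu : IsAOneWeight K u) (hv : IsAOneWeight L v) :
    IsApWeight p (K * L ^ (p - 1)) fun x => u x * v x ^ (1 - p) where
  measurable := hu.measurable.mul (hv.measurable.pow_const _)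
  ae_ne_zero := by
    filter_upwards [hu.ae_ne_zero, hv.ae_ne_zero, hv.ae_ne_top] with x h1 h2 h3
    exact mul_ne_zero h1 (ENNReal.rpow_pos (pos_iff_ne_zero.2 h2) h3).ne'
  ae_ne_top := by
    filter_upwards [hu.ae_ne_top, hv.ae_ne_zero, hv.ae_ne_top] with x h1 h2 h3
    exact ENNReal.mul_ne_top h1 (ENNReal.rpow_ne_top_of_ne_zero h2 h3)
  bound a b hab := by
    have hp1 : 0 < p - 1 := by linarith
    obtain ⟨c, hc0, hct, hcu, hc⟩ := hu.exists_lower_bound hab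
    obtain ⟨e, he0, het, hev, he⟩ := hv.exists_lower_bound hab
    set d := ENNReal.ofReal (b - a) with hd
    have hd0 : d ≠ 0 := by simpa [hd] using hab
    have hdt : d ≠ ∞ := ENNReal.ofReal_ne_top
    -- The negative powers of `v` here, and of `u` in the dual integral, are replaced by those of
    -- their lower bounds; what is left is an integral of `u` or of `v`.
    have h1 : ∫⁻ x in Set.Icc a b, u x * v x ^ (1 - p) ≤ K * d * c * e ^ (1 - p) := by
      rw [← hcu, ← lintegral_mul_const _ hu.measurable]
      refine lintegral_mono_ae ?_
      filter_upwards [ae_restrict_of_ae he, ae_restrict_mem measurableSet_Icc] with x hx hxI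
      refine mul_le_mul_right ?_ _
      exact ennreal_rpow_le_rpow_of_nonpos (by linarith) (hx hxI)
    have h2 : ∫⁻ x in Set.Icc a b, (u x * v x ^ (1 - p)) ^ (-(1 / (p - 1))) ≤
        c ^ (-(1 / (p - 1))) * (L * d * e) := by
      rw [← hev, ← lintegral_const_mul _ hv.measurable]
      refine lintegral_mono_ae ?_
      filter_upwards [ae_restrict_of_ae hc, ae_restrict_mem measurableSet_Icc,
        ae_restrict_of_ae hu.ae_ne_zero, ae_restrict_of_ae hu.ae_ne_top,
        ae_restrict_of_ae hv.ae_ne_zero, ae_restrict_of_ae hv.ae_ne_top] with x hx hxI u0 ut v0 vt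
      rw [ENNReal.mul_rpow_of_ne_top ut (ENNReal.rpow_ne_top_of_ne_zero v0 vt), ← ENNReal.rpow_mul,
        show (1 - p) * -(1 / (p - 1)) = 1 by field_simp; ring, ENNReal.rpow_one]
      refine mul_le_mul_left ?_ _
      exact ennreal_rpow_le_rpow_of_nonpos (by simpa using hp.le) (hx hxI)
    calc _ ≤ K * d * c * e ^ (1 - p) * (c ^ (-(1 / (p - 1))) * (L * d * e)) ^ (p - 1) := by
          gcongr
      _ = K * d * c * e ^ (1 - p) * (c ^ (-1 : ℝ) * (L ^ (p - 1) * d ^ (p - 1) * e ^ (p - 1))) := by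
          simp only [ENNReal.mul_rpow_of_nonneg _ _ hp1.le, ← ENNReal.rpow_mul]
          rw [show -(1 / (p - 1)) * (p - 1) = -1 by field_simp]
      _ = K * L ^ (p - 1) * (d * d ^ (p - 1)) * (c * c ^ (-1 : ℝ)) * (e ^ (1 - p) * e ^ (p - 1)) := by
          ring
      _ = _ := by
          rw [← ENNReal.rpow_add _ _ he0 het, ENNReal.rpow_neg_one, ENNReal.mul_inv_cancel hc0 hct]
          nth_rewrite 1 [← ENNReal.rpow_one d]
          rw [← ENNReal.rpow_add _ _ hd0 hdt, ENNReal.coe_mul,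
            ENNReal.coe_rpow_of_nonneg _ hp1.le]
          simp

theorem isAOneWeight_one : IsAOneWeight 1 fun _ => 1 where
  measurable := measurable_const
  ae_ne_zero := by simp
  ae_ne_top := by simp
  bound a b hab := by simp

theorem isApWeight_one {p : ℝ} (hp : 1 < p) : IsApWeight p 1 fun _ => 1 := by
  simpa using isAOneWeight_one.mul_rpow hp isAOneWeight_one

/-- A substitute for Minkowski's inequality: split 4⁻ᵏ as 2⁻ᵏ · 2⁻ᵏ, bound the sum by twice the
supremum of the 2⁻ᵏ bₖ, and the p-th power of that supremum by a sum. -/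
theorem rpow_tsum_le {p : ℝ} (hp : 1 < p) (b : ℕ → ℝ≥0∞) :
    (∑' k, (4⁻¹ : ℝ≥0∞) ^ k * b k) ^ p ≤ 2 ^ p * ∑' k, (2⁻¹ : ℝ≥0∞) ^ k * b k ^ p := by
  have hp0 : 0 < p := by linarith
  have h2 : ∑' k : ℕ, (2⁻¹ : ℝ≥0∞) ^ k = 2 := by
    rw [ENNReal.tsum_geometric, ENNReal.one_sub_inv_two, inv_inv]
  have h1 : ∑' k, (4⁻¹ : ℝ≥0∞) ^ k * b k ≤ 2 * ⨆ k, (2⁻¹ : ℝ≥0∞) ^ k * b k := by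
    conv_rhs => rw [← h2, ← ENNReal.tsum_mul_right]
    refine ENNReal.tsum_le_tsum fun k => ?_
    simp only [h2]
    rw [show (4 : ℝ≥0∞) = 2 * 2 by norm_num, ENNReal.mul_inv (by simp) (by simp), mul_pow, mul_assoc]
    exact mul_le_mul_right (le_iSup (fun k => (2⁻¹ : ℝ≥0∞) ^ k * b k) k) _
  refine (ENNReal.rpow_le_rpow h1 hp0.le).trans ?_
  rw [ENNReal.mul_rpow_of_nonneg _ _ hp0.le]
  refine mul_le_mul_right ?_ _
  rw [← ENNReal.le_rpow_inv_iff hp0]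
  refine iSup_le fun k => ?_
  rw [ENNReal.le_rpow_inv_iff hp0, ENNReal.mul_rpow_of_nonneg _ _ hp0.le]
  refine le_trans ?_ (ENNReal.le_tsum k)
  refine mul_le_mul_left ?_ _
  refine ENNReal.rpow_le_self_of_le_one ?_ hp.le
  exact pow_le_one₀ zero_le (by simp)

/-- Rubio de Francia's algorithm: every function of `L^p(w)`, with `w` an `A_p` weight, has an
`A_1` majorant with comparable norm. -/
theorem exists_isAOneWeight_majorant {p : ℝ} (hp : 1 < p) (K : ℝ≥0) :
    ∃ C L : ℝ≥0, ∀ w, IsApWeight p K w → ∀ h : ℝ → ℝ≥0∞, Measurable h →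
      ∫⁻ x, h x ^ p * w x ≠ ∞ → (¬ ∀ᵐ x, h x = 0) →
      ∃ H, IsAOneWeight L H ∧ (∀ x, h x ≤ H x) ∧
        ∫⁻ x, H x ^ p * w x ≤ C * ∫⁻ x, h x ^ p * w x := by
  have hp0 : 0 < p := by linarith
  obtain ⟨C, hC⟩ := exists_ratMaximal_weighted hp K
  -- `N` bounds the operator norm of the maximal operator on L^p(w); the added 1 makes it
  -- invertible.
  set N : ℝ≥0 := C ^ (1 / p) + 1 with hN
  have hN0 : (N : ℝ≥0∞) ≠ 0 := by simp [hN]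
  have hNt : (N : ℝ≥0∞) ≠ ∞ := ENNReal.coe_ne_top
  have hNp : (C : ℝ≥0∞) ≤ (N : ℝ≥0∞) ^ p := by
    rw [← ENNReal.coe_rpow_of_nonneg _ hp0.le, ENNReal.coe_le_coe]
    calc C = (C ^ (1 / p)) ^ p := by
          rw [← NNReal.rpow_mul, one_div_mul_cancel hp0.ne', NNReal.rpow_one]
      _ ≤ N ^ p := by gcongr; exact le_self_add
  refine ⟨2 ^ p * 2, 4 * N, fun w hw h hh hfin hne => ?_⟩
  let F : ℕ → ℝ → ℝ≥0∞ := fun k => (ratMaximal volume)^[k] h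
  have hF0 : F 0 = h := rfl
  have hFs : ∀ k, F (k + 1) = ratMaximal volume (F k) := fun k =>
    Function.iterate_succ_apply' _ _ _
  have hFm : ∀ k, Measurable (F k) := by
    intro k
    cases k with
    | zero => exact hh
    | succ k => rw [hFs]; exact measurable_ratMaximal _ _
  have hiter : ∀ k, ∫⁻ x, ((N : ℝ≥0∞)⁻¹ ^ k * F k x) ^ p * w x ≤ ∫⁻ x, h x ^ p * w x := by
    intro k
    induction k with
    | zero => simp [hF0]
    | succ k ih =>
      refine le_trans ?_ ih
      have e : ∀ k : ℕ, ∀ x, ((N : ℝ≥0∞)⁻¹ ^ k * F k x) ^ p * w x =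
          ((N : ℝ≥0∞)⁻¹ ^ p) ^ k * (F k x ^ p * w x) := by
        intro k x
        rw [ENNReal.mul_rpow_of_nonneg _ _ hp0.le, mul_assoc, ← ENNReal.rpow_natCast,
          ← ENNReal.rpow_mul, mul_comm (k : ℝ), ENNReal.rpow_mul, ENNReal.rpow_natCast]
      simp only [e]
      have hwm := hw.measurable
      have hFpm : ∀ k, Measurable fun x => F k x ^ p * w x := fun k =>
        ((hFm k).pow_const p).mul hwm
      rw [lintegral_const_mul _ (hFpm _), lintegral_const_mul _ (hFpm _), pow_succ, mul_assoc, hFs]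
      refine mul_le_mul_right ?_ _
      rw [ENNReal.inv_rpow, ← ENNReal.div_eq_inv_mul]
      refine ENNReal.div_le_of_le_mul' ?_
      exact (hC w hw _ (hFm k)).trans (mul_le_mul_left hNp _)
  -- The maximal operator shifts this series by one place, up to the factor 4N, which becomes the
  -- A_1 constant. The 4 provides the decay for `rpow_tsum_le`.
  let H : ℝ → ℝ≥0∞ := fun x => ∑' k, ((4 * N : ℝ≥0∞)⁻¹) ^ k * F k x
  have hHm : Measurable H := Measurable.tsum fun k => (hFm k).const_mul _
  have h4N0 : (4 * N : ℝ≥0∞) ≠ 0 := mul_ne_zero (by norm_num) hN0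
  have h4Nt : (4 * N : ℝ≥0∞) ≠ ∞ := ENNReal.mul_ne_top (by norm_num) hNt
  have hterm : ∀ k x, ((4 * N : ℝ≥0∞)⁻¹) ^ k * F k x ≤ H x := fun k x => ENNReal.le_tsum k
  have hnorm : ∫⁻ x, H x ^ p * w x ≤ 2 ^ p * 2 * ∫⁻ x, h x ^ p * w x := by
    calc ∫⁻ x, H x ^ p * w x
        ≤ ∫⁻ x, 2 ^ p * ∑' k : ℕ, (2⁻¹ : ℝ≥0∞) ^ k * (((N : ℝ≥0∞)⁻¹ ^ k * F k x) ^ p * w x) := by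
          refine lintegral_mono fun x => ?_
          have hx := rpow_tsum_le hp fun k => (N : ℝ≥0∞)⁻¹ ^ k * F k x
          have hHx : H x = ∑' k, (4⁻¹ : ℝ≥0∞) ^ k * ((N : ℝ≥0∞)⁻¹ ^ k * F k x) := by
            refine tsum_congr fun k => ?_
            rw [ENNReal.mul_inv (by simp) (by simp), mul_pow, mul_assoc]
          rw [hHx]
          refine (mul_le_mul_left hx (w x)).trans (le_of_eq ?_)
          rw [mul_assoc, ← ENNReal.tsum_mul_right]
          simp only [mul_assoc]
      _ = 2 ^ p * ∑' k : ℕ, (2⁻¹ : ℝ≥0∞) ^ k * ∫⁻ x, ((N : ℝ≥0∞)⁻¹ ^ k * F k x) ^ p * w x := by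
          have hm : ∀ k : ℕ, Measurable fun x => ((N : ℝ≥0∞)⁻¹ ^ k * F k x) ^ p * w x := fun k =>
            (((hFm k).const_mul _).pow_const p).mul hw.measurable
          rw [lintegral_const_mul _ (Measurable.tsum fun k => (hm k).const_mul _),
            lintegral_tsum fun k => ((hm k).const_mul _).aemeasurable]
          simp only [lintegral_const_mul _ (hm _)]
      _ ≤ 2 ^ p * ∑' k : ℕ, (2⁻¹ : ℝ≥0∞) ^ k * ∫⁻ x, h x ^ p * w x := by
          exact mul_le_mul_right (ENNReal.tsum_le_tsum fun k => mul_le_mul_right (hiter k) _) _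
      _ = _ := by
          rw [ENNReal.tsum_mul_right, ENNReal.tsum_geometric, ENNReal.one_sub_inv_two, inv_inv,
            mul_assoc]
  have hMH : ∀ x, ratMaximal volume H x ≤ (4 * N : ℝ≥0∞) * H x := by
    intro x
    refine (ratMaximal_tsum_le F hFm _ x).trans ?_
    rw [← ENNReal.tsum_mul_left]
    calc ∑' k, ((4 * N : ℝ≥0∞)⁻¹) ^ k * ratMaximal volume (F k) x
        = ∑' k, (4 * N : ℝ≥0∞) * (((4 * N : ℝ≥0∞)⁻¹) ^ (k + 1) * F (k + 1) x) := by
          refine tsum_congr fun k => ?_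
          rw [hFs, pow_succ', ← mul_assoc, ← mul_assoc, ENNReal.mul_inv_cancel h4N0 h4Nt, one_mul]
      _ ≤ _ := ENNReal.tsum_comp_le_tsum_of_injective (add_left_injective 1)
          fun k => (4 * N : ℝ≥0∞) * (((4 * N : ℝ≥0∞)⁻¹) ^ k * F k x)
  refine ⟨H, ⟨hHm, ?_, ?_, ?_⟩, ?_, ?_⟩
  · refine Filter.Eventually.of_forall fun x hx => ?_
    have h1 := hterm 1 x
    rw [hx, nonpos_iff_eq_zero, pow_one, mul_eq_zero, ENNReal.inv_eq_zero, hFs] at h1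
    rcases h1 with h1 | h1
    · exact h4Nt h1
    · exact ratMaximal_ne_zero hh hne x h1
  · have hlt : ∫⁻ x, H x ^ p * w x ≠ ∞ := ne_top_of_le_ne_top
      (ENNReal.mul_ne_top (ENNReal.mul_ne_top
        (ENNReal.rpow_ne_top_of_nonneg hp0.le (by norm_num)) (by norm_num)) hfin) hnorm
    filter_upwards [ae_lt_top ((hHm.pow_const p).mul hw.measurable) hlt, hw.ae_ne_zero]
      with x hx hx0 hHx
    rw [Pi.mul_apply, hHx, ENNReal.top_rpow_of_pos hp0, ENNReal.top_mul hx0] at hx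
    exact lt_irrefl _ hx
  · refine fun a b hab => Filter.Eventually.of_forall fun x hx => ?_
    refine (setLIntegral_Icc_le_ratMaximal H hab hx).trans ?_
    rw [mul_right_comm]
    refine mul_le_mul_left ?_ _
    simpa using hMH x
  · intro x
    simpa [hF0] using hterm 0 x
  · refine hnorm.trans (le_of_eq ?_)
    rw [ENNReal.coe_mul, ENNReal.coe_rpow_of_nonneg _ hp0.le]
    simp

/-- The pair `(f, g)` satisfies the weighted `L^p` estimate for all `A_p` weights, with a constant
that depends only on the `A_p` constant. -/
def WeightedBound (p : ℝ) (φ : ℝ≥0 → ℝ≥0) (f g : ℝ → ℝ≥0∞) : Prop :=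
  ∀ K w, IsApWeight p K w → ∫⁻ x, f x ^ p * w x ≤ φ K * ∫⁻ x, g x ^ p * w x

/-- When a ≥ b, the factor (a / b)^(p-1) is at least 1. -/
theorem le_add_rpow_mul_rpow {p : ℝ} (hp : 1 < p) {a b : ℝ≥0∞} (hb0 : b ≠ 0) (hbt : b ≠ ∞) :
    a ≤ b + a ^ p * b ^ (1 - p) := by
  rcases le_total a b with h | h
  · exact le_add_right h
  · refine le_add_left ?_
    calc a = a * (b ^ (p - 1) * b ^ (1 - p)) := by
          rw [← ENNReal.rpow_add _ _ hb0 hbt]; simp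
      _ ≤ a * (a ^ (p - 1) * b ^ (1 - p)) := by
          gcongr
      _ = a ^ p * b ^ (1 - p) := by
          rw [← mul_assoc]
          nth_rewrite 1 [← ENNReal.rpow_one a]
          rw [← ENNReal.rpow_add_of_nonneg _ _ zero_le_one (by linarith), add_sub_cancel]

/-- The estimate of `∫ f V` by `∫ U V`, for `A_1` weights `U` and `V` with `g ≤ U`. -/
theorem WeightedBound.lintegral_mul_le {p : ℝ} (hp : 1 < p) {φ : ℝ≥0 → ℝ≥0} {f g : ℝ → ℝ≥0∞}
    (h : WeightedBound p φ f g) {K L : ℝ≥0} {U V : ℝ → ℝ≥0∞}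
    (hU : IsAOneWeight K U) (hV : IsAOneWeight L V) (hgU : ∀ x, g x ≤ U x) :
    ∫⁻ x, f x * V x ≤ (1 + φ (L * K ^ (p - 1))) * ∫⁻ x, U x * V x := by
  have hUm := hU.measurable
  have hVm := hV.measurable
  calc ∫⁻ x, f x * V x ≤ ∫⁻ x, U x * V x + f x ^ p * (V x * U x ^ (1 - p)) := by
        refine lintegral_mono_ae ?_
        filter_upwards [hU.ae_ne_zero, hU.ae_ne_top] with x h0 ht
        calc f x * V x ≤ (U x + f x ^ p * U x ^ (1 - p)) * V x :=
              mul_le_mul_left (le_add_rpow_mul_rpow hp h0 ht) _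
          _ = _ := by ring
    _ = (∫⁻ x, U x * V x) + ∫⁻ x, f x ^ p * (V x * U x ^ (1 - p)) :=
        lintegral_add_left (hUm.mul hVm) _
    _ ≤ (∫⁻ x, U x * V x) + φ (L * K ^ (p - 1)) * ∫⁻ x, g x ^ p * (V x * U x ^ (1 - p)) := by
        gcongr
        exact h _ _ (hV.mul_rpow hp hU)
    _ ≤ (∫⁻ x, U x * V x) + φ (L * K ^ (p - 1)) * ∫⁻ x, U x * V x := by
        refine add_le_add_right (mul_le_mul_right (lintegral_mono_ae ?_) _) _
        filter_upwards [hU.ae_ne_zero, hU.ae_ne_top] with x h0 ht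
        calc g x ^ p * (V x * U x ^ (1 - p)) ≤ U x ^ p * (V x * U x ^ (1 - p)) := by
              gcongr; exact hgU x
          _ = (U x ^ p * U x ^ (1 - p)) * V x := by ring
          _ = U x * V x := by rw [← ENNReal.rpow_add _ _ h0 ht]; simp
    _ = _ := by rw [add_mul, one_mul]

/-- Hölder's inequality after inserting w^(1/p) · w^(-1/p); the conjugate exponent turns the second
factor into the dual weight. -/
theorem lintegral_mul_le_weighted {p : ℝ} (hp : 1 < p) {K : ℝ≥0} {w U V : ℝ → ℝ≥0∞}
    (hw : IsApWeight p K w) (hU : Measurable U) (hV : Measurable V) :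
    ∫⁻ x, U x * V x ≤ (∫⁻ x, U x ^ p * w x) ^ (1 / p) *
      (∫⁻ x, V x ^ (p / (p - 1)) * w x ^ (-(1 / (p - 1)))) ^ (1 / (p / (p - 1))) := by
  have hp0 : 0 < p := by linarith
  have hp1 : 0 < p - 1 := by linarith
  have hp0' : 0 < p / (p - 1) := by positivity
  have hwm := hw.measurable
  have hconj : p.HolderConjugate (p / (p - 1)) := Real.HolderConjugate.conjExponent hp
  have h := ENNReal.lintegral_mul_le_Lp_mul_Lq volume hconj
    (f := fun x => U x * w x ^ (1 / p)) (g := fun x => V x * w x ^ (-(1 / p)))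
    (by fun_prop) (by fun_prop)
  simp only [Pi.mul_apply, ENNReal.mul_rpow_of_nonneg _ _ hp0.le,
    ENNReal.mul_rpow_of_nonneg _ _ hp0'.le, ← ENNReal.rpow_mul] at h
  rw [show 1 / p * p = 1 by field_simp,
    show -(1 / p) * (p / (p - 1)) = -(1 / (p - 1)) by field_simp] at h
  simp only [ENNReal.rpow_one] at h
  refine le_trans (lintegral_mono_ae ?_) h
  filter_upwards [hw.ae_ne_zero, hw.ae_ne_top] with x h0 ht
  refine le_of_eq ?_
  calc U x * V x = U x * V x * (w x ^ (1 / p) * w x ^ (-(1 / p))) := by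
        rw [← ENNReal.rpow_add _ _ h0 ht]; simp
    _ = _ := by ring

/-- Truncate in height and support and apply Fatou. The truncations have finite norm since an A_p
weight is locally integrable, so a power of their norm can later be cancelled. -/
theorem lintegral_rpow_mul_le_of_truncations {p : ℝ} (hp : 1 < p) {K : ℝ≥0} {w f : ℝ → ℝ≥0∞}
    (hw : IsApWeight p K w) (hf : Measurable f) {C : ℝ≥0∞}
    (h : ∀ F : ℝ → ℝ≥0∞, Measurable F → (∀ x, F x ≤ f x) → ∫⁻ x, F x ^ p * w x ≠ ∞ →
      ∫⁻ x, F x ^ p * w x ≤ C) : ∫⁻ x, f x ^ p * w x ≤ C := by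
  have hp0 : 0 < p := by linarith
  let F : ℕ → ℝ → ℝ≥0∞ := fun k => (Set.Icc (-(k + 1) : ℝ) (k + 1)).indicator fun x => min (f x) k
  have hFm : ∀ k, Measurable (F k) := fun k => (hf.min measurable_const).indicator measurableSet_Icc
  have hFle : ∀ k x, F k x ≤ f x := fun k x =>
    (Set.indicator_le_self _ _ x).trans (min_le_left _ _)
  have hFfin : ∀ k, ∫⁻ x, F k x ^ p * w x ≠ ∞ := by
    intro k
    have hk : (-(k + 1) : ℝ) < k + 1 := by have := k.cast_nonneg (α := ℝ); linarith
    refine ne_top_of_le_ne_top (ENNReal.mul_ne_top (ENNReal.rpow_ne_top_of_nonneg hp0.le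
      (ENNReal.natCast_ne_top k)) (hw.setLIntegral_ne_top hp hk)) ?_
    rw [← lintegral_const_mul _ hw.measurable, ← lintegral_indicator measurableSet_Icc]
    refine lintegral_mono fun x => ?_
    by_cases hx : x ∈ Set.Icc (-(k + 1) : ℝ) (k + 1)
    · simp only [F, Set.indicator_of_mem hx]
      gcongr
      exact min_le_right _ _
    · simp only [F, Set.indicator_of_notMem hx]
      simp [hp0]
  have hlim : ∀ᵐ x, Filter.Tendsto (fun k => F k x ^ p * w x) Filter.atTop
      (nhds (f x ^ p * w x)) := by
    filter_upwards [hw.ae_ne_top] with x hx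
    refine ENNReal.Tendsto.mul_const ?_ (Or.inr hx)
    refine (ENNReal.continuous_rpow_const.tendsto (f x)).comp ?_
    have h1 : Filter.Tendsto (fun k : ℕ => min (f x) (k : ℝ≥0∞)) Filter.atTop (nhds (f x)) := by
      have := (tendsto_const_nhds (x := f x)).min ENNReal.tendsto_nat_nhds_top
      simpa using this
    refine h1.congr' ?_
    obtain ⟨n, hn⟩ := exists_nat_ge |x|
    filter_upwards [Filter.eventually_ge_atTop n] with k hk
    have hk' : (n : ℝ) ≤ k := by exact_mod_cast hk
    have hx : x ∈ Set.Icc (-(k + 1) : ℝ) (k + 1) := abs_le.1 (by linarith)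
    simp only [F, Set.indicator_of_mem hx]
  calc ∫⁻ x, f x ^ p * w x = ∫⁻ x, Filter.liminf (fun k => F k x ^ p * w x) Filter.atTop := by
        refine lintegral_congr_ae ?_
        filter_upwards [hlim] with x hx using hx.liminf_eq.symm
    _ ≤ Filter.liminf (fun k => ∫⁻ x, F k x ^ p * w x) Filter.atTop :=
        lintegral_liminf_le fun k => ((hFm k).pow_const p).mul hw.measurable
    _ ≤ Filter.liminf (fun _ : ℕ => C) Filter.atTop :=
        Filter.liminf_le_liminf (Filter.Eventually.of_forall fun k =>
          h (F k) (hFm k) (hFle k) (hFfin k))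
    _ = C := Filter.liminf_const C

/-- Rubio de Francia's extrapolation theorem. -/
theorem exists_weightedBound_of_weightedBound {p₀ p : ℝ} (hp₀ : 1 < p₀) (hp : 1 < p)
    (φ : ℝ≥0 → ℝ≥0) : ∃ ψ : ℝ≥0 → ℝ≥0, ∀ f g : ℝ → ℝ≥0∞, Measurable f → Measurable g →
      WeightedBound p₀ φ f g → WeightedBound p ψ f g := by
  have hp0 : 0 < p := by linarith
  have h₀ : 0 < p₀ := by linarith
  have hp1 : 0 < p - 1 := by linarith
  have hp' : 1 < p / (p - 1) := by rw [lt_div_iff₀ hp1]; linarith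
  have hp0' : 0 < p / (p - 1) := by linarith
  choose C₁ L₁ hmaj₁ using exists_isAOneWeight_majorant hp
  choose C₂ L₂ hmaj₂ using exists_isAOneWeight_majorant hp'
  let D : ℝ≥0 → ℝ≥0 := fun K =>
    (1 + φ (L₂ (K ^ (1 / (p - 1))) * L₁ K ^ (p₀ - 1))) * (C₁ K ^ (1 / p) *
      C₂ (K ^ (1 / (p - 1))) ^ (1 / (p / (p - 1))))
  refine ⟨fun K => (D K + 1) ^ p, fun f g hf hg hfg K w hw => ?_⟩
  have hwm := hw.measurable
  set G := ∫⁻ x, g x ^ p * w x with hG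
  -- A null `g` has no positive majorant of comparable norm; here the hypothesis with weight 1
  -- forces `f` to be null.
  by_cases hg0 : ∀ᵐ x, g x = 0
  · have h1 := hfg 1 _ (isApWeight_one hp₀)
    have h2 : ∫⁻ x, g x ^ p₀ * 1 = 0 := by
      rw [lintegral_eq_zero_iff (by fun_prop)]
      filter_upwards [hg0] with x hx
      simp [hx, h₀]
    rw [h2, mul_zero, nonpos_iff_eq_zero, lintegral_eq_zero_iff (by fun_prop)] at h1
    have h3 : ∫⁻ x, f x ^ p * w x = 0 := by
      rw [lintegral_eq_zero_iff (by fun_prop)]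
      filter_upwards [h1] with x hx
      simp only [Pi.zero_apply, mul_one, ENNReal.rpow_eq_zero_iff_of_pos h₀] at hx
      simp [hx, hp0]
    rw [h3]
    exact zero_le
  by_cases hGt : G = ∞
  · rw [hGt, ENNReal.mul_top]
    · exact le_top
    · exact_mod_cast (NNReal.rpow_pos (by positivity)).ne'
  obtain ⟨U, hU, hgU, hUG⟩ := hmaj₁ K w hw g hg hGt hg0
  refine lintegral_rpow_mul_le_of_truncations hp hw hf fun F hF hFf hFt => ?_
  set I := ∫⁻ x, F x ^ p * w x with hI
  by_cases hI0 : I = 0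
  · rw [hI0]; exact zero_le
  have hFw : ∀ x, F x ^ p * w x = F x * (F x ^ (p - 1) * w x) := by
    intro x
    rw [← mul_assoc]
    nth_rewrite 2 [← ENNReal.rpow_one (F x)]
    rw [← ENNReal.rpow_add_of_nonneg _ _ zero_le_one hp1.le, add_sub_cancel]
  have hnorm : ∫⁻ x, (F x ^ (p - 1) * w x) ^ (p / (p - 1)) * w x ^ (-(1 / (p - 1))) = I := by
    refine lintegral_congr_ae ?_
    filter_upwards [hw.ae_ne_zero, hw.ae_ne_top] with x h0 ht
    rw [ENNReal.mul_rpow_of_nonneg _ _ hp0'.le, ← ENNReal.rpow_mul, mul_div_cancel₀ _ hp1.ne',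
      mul_assoc, ← ENNReal.rpow_add _ _ h0 ht, show p / (p - 1) + -(1 / (p - 1)) = 1 by
        field_simp; ring, ENNReal.rpow_one]
  have hne : ¬ ∀ᵐ x, F x ^ (p - 1) * w x = 0 := by
    intro hzero
    refine hI0 ((lintegral_eq_zero_iff (by fun_prop)).2 ?_)
    filter_upwards [hzero] with x hx
    rw [hFw, hx, mul_zero, Pi.zero_apply]
  -- F^(p-1) w is the function dual to `F`: pairing the two gives `I`, and its norm integral in the
  -- dual space is again `I`.
  obtain ⟨V, hV, hFV, hVI⟩ := hmaj₂ _ _ (hw.dual hp) (fun x => F x ^ (p - 1) * w x) (by fun_prop)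
    (by rw [hnorm]; exact hFt) hne
  rw [hnorm] at hVI
  have hbound : I ≤ D K * G ^ (1 / p) * I ^ (1 / (p / (p - 1))) := by
    calc I = ∫⁻ x, F x * (F x ^ (p - 1) * w x) := lintegral_congr hFw
      _ ≤ ∫⁻ x, f x * V x := by
          refine lintegral_mono fun x => ?_
          exact mul_le_mul' (hFf x) (hFV x)
      _ ≤ (1 + φ (L₂ (K ^ (1 / (p - 1))) * L₁ K ^ (p₀ - 1))) * ∫⁻ x, U x * V x :=
          hfg.lintegral_mul_le hp₀ hU hV hgU
      _ ≤ (1 + φ (L₂ (K ^ (1 / (p - 1))) * L₁ K ^ (p₀ - 1))) * ((C₁ K * G) ^ (1 / p) *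
            (C₂ (K ^ (1 / (p - 1))) * I) ^ (1 / (p / (p - 1)))) := by
          refine mul_le_mul_right ((lintegral_mul_le_weighted hp hw hU.measurable
            hV.measurable).trans ?_) _
          gcongr
      _ = _ := by
          rw [ENNReal.mul_rpow_of_nonneg _ _ (one_div_pos.2 hp0).le,
            ENNReal.mul_rpow_of_nonneg _ _ (one_div_pos.2 hp0').le]
          simp only [D, ENNReal.coe_mul, ENNReal.coe_add, ENNReal.coe_one,
            ENNReal.coe_rpow_of_nonneg _ (one_div_pos.2 hp0).le,
            ENNReal.coe_rpow_of_nonneg _ (one_div_pos.2 hp0').le]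
          ring
  have hsplit : I = I ^ (1 / p) * I ^ (1 / (p / (p - 1))) := by
    rw [← ENNReal.rpow_add _ _ hI0 hFt, show 1 / p + 1 / (p / (p - 1)) = 1 by field_simp; ring,
      ENNReal.rpow_one]
  nth_rewrite 1 [hsplit] at hbound
  rw [ENNReal.mul_le_mul_iff_left (ENNReal.rpow_pos (pos_iff_ne_zero.2 hI0) hFt).ne'
    (ENNReal.rpow_ne_top_of_ne_zero hI0 hFt)] at hbound
  have h := ENNReal.rpow_le_rpow hbound hp0.le
  rw [ENNReal.mul_rpow_of_nonneg _ _ hp0.le, ← ENNReal.rpow_mul, ← ENNReal.rpow_mul,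
    one_div_mul_cancel hp0.ne', ENNReal.rpow_one, ENNReal.rpow_one] at h
  refine h.trans (mul_le_mul_left ?_ G)
  rw [ENNReal.coe_rpow_of_nonneg _ hp0.le]
  gcongr
  exact le_self_add

/-! ### Mixed norms -/

theorem mixedNorm_succ {n : ℕ} (p : Fin (n + 1) → ℝ) (F : (Fin (n + 1) → ℝ) → ℝ≥0∞) :
    mixedNorm p F = (∫⁻ s : ℝ, mixedNorm (fun j : Fin n => p j.castSucc)
      (fun y : Fin n → ℝ => F (Fin.snoc (α := fun _ => ℝ) y s)) ^ p (Fin.last n))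
        ^ (1 / p (Fin.last n)) := rfl

theorem mixedNorm_rpow {n : ℕ} (p : Fin n → ℝ) {t : ℝ} (ht : 0 < t) (F : (Fin n → ℝ) → ℝ≥0∞) :
    mixedNorm p (fun x => F x ^ (1 / t)) = mixedNorm (fun j => p j / t) F ^ (1 / t) := by
  induction n with
  | zero => rfl
  | succ n ih =>
    simp only [mixedNorm_succ, ih, ← ENNReal.rpow_mul]
    congr 1
    · simp only [one_div_mul_eq_div]
    · field_simp

theorem measurable_snoc {n : ℕ} :
    Measurable fun z : (Fin n → ℝ) × ℝ => Fin.snoc (α := fun _ => ℝ) z.1 z.2 := by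
  refine measurable_pi_lambda _ fun j => ?_
  refine Fin.lastCases ?_ (fun i => ?_) j
  · simpa using measurable_snd
  · simp only [Fin.snoc_castSucc]
    exact (measurable_pi_apply i).comp measurable_fst

theorem measurable_mixedNorm {n : ℕ} (p : Fin n → ℝ) {α : Type} [MeasurableSpace α]
    {F : α → (Fin n → ℝ) → ℝ≥0∞} (hF : Measurable (Function.uncurry F)) :
    Measurable fun a => mixedNorm p (F a) := by
  induction n generalizing α with
  | zero => exact hF.comp (measurable_id.prodMk measurable_const)
  | succ n ih =>
    have h : Measurable fun z : α × ℝ => mixedNorm (fun j : Fin n => p j.castSucc)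
        (fun y : Fin n → ℝ => F z.1 (Fin.snoc (α := fun _ => ℝ) y z.2)) := by
      refine ih _ (F := fun (z : α × ℝ) y => F z.1 (Fin.snoc (α := fun _ => ℝ) y z.2)) ?_
      exact hF.comp ((measurable_fst.comp measurable_fst).prodMk
        (measurable_snoc.comp (measurable_snd.prodMk (measurable_snd.comp measurable_fst))))
    exact (h.pow_const _).lintegral_prod_right'.pow_const _

theorem ae_insertNth_iff {n : ℕ} (k : Fin (n + 1)) (P : (Fin (n + 1) → ℝ) → Prop) :
    (∀ᵐ x, P x) ↔ ∀ᵐ z : ℝ × (Fin n → ℝ), P (k.insertNth (α := fun _ => ℝ) z.1 z.2) := by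
  have h := (volume_preserving_piFinSuccAbove (fun _ : Fin (n + 1) => ℝ) k).symm
  rw [← h.map_eq, (MeasurableEquiv.measurableEmbedding _).ae_map_iff]
  rfl

/-- By Fubini almost every slice of the two functions agrees almost everywhere. This allows
replacing a Lebesgue measurable function by a Borel one. -/
theorem mixedNorm_congr_ae {n : ℕ} (p : Fin n → ℝ) {F G : (Fin n → ℝ) → ℝ≥0∞}
    (h : F =ᵐ[volume] G) : mixedNorm p F = mixedNorm p G := by
  induction n with
  | zero =>
    have : F = G := by
      obtain ⟨x, hx⟩ := h.exists
      funext y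
      rw [Subsingleton.elim y x, hx]
    rw [this]
  | succ n ih =>
    have h' := (ae_insertNth_iff (Fin.last n) fun x => F x = G x).1 h
    simp only [Fin.insertNth_last'] at h'
    rw [mixedNorm_succ, mixedNorm_succ]
    congr 1
    refine lintegral_congr_ae ?_
    filter_upwards [Measure.ae_ae_of_ae_prod h'] with s hs
    rw [ih _ hs]

/-! ### Maximal operators in the coordinate directions -/

theorem directionalMaximal_eq_ratMaximal {n : ℕ} (k : Fin n) (F : (Fin n → ℝ) → ℝ≥0∞)
    (x : Fin n → ℝ) : directionalMaximal k F x =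
      ratMaximal volume (fun s => F (Function.update x k s)) (x k) := by
  refine le_antisymm ?_ (ratMaximal_le_iff.2 fun q hx => ?_)
  · refine iSup_le fun a => iSup_le fun b => iSup_le fun hab => iSup_le fun hx => ?_
    exact ENNReal.div_le_of_le_mul (setLIntegral_Icc_le_ratMaximal _ hab hx)
  · rcases (hx.1.trans hx.2).eq_or_lt with hq | hq
    · rw [← hq]; simp
    · rw [Real.volume_Icc]
      exact le_iSup_of_le (q.1 : ℝ) (le_iSup_of_le (q.2 : ℝ)
        (le_iSup_of_le hq (le_iSup_of_le hx le_rfl)))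

theorem measurable_ratMaximal_param {β : Type*} [MeasurableSpace β] {G : β → ℝ → ℝ≥0∞}
    (hG : Measurable (Function.uncurry G)) :
    Measurable fun z : β × ℝ => ratMaximal volume (G z.1) z.2 := by
  refine .iSup fun q => ?_
  have h : Measurable fun z : β × ℝ => (∫⁻ y in Set.Icc (q.1 : ℝ) q.2, G z.1 y) /
      volume (Set.Icc (q.1 : ℝ) q.2) :=
    ((Measurable.lintegral_prod_right' hG).comp measurable_fst).div measurable_const
  exact h.indicator (measurable_snd measurableSet_Icc)

theorem measurable_directionalMaximal {n : ℕ} (k : Fin n) {F : (Fin n → ℝ) → ℝ≥0∞}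
    (hF : Measurable F) : Measurable (directionalMaximal k F) := by
  have h : Measurable (Function.uncurry fun (x : Fin n → ℝ) s => F (Function.update x k s)) :=
    hF.comp measurable_update'
  rw [show directionalMaximal k F = _ from funext (directionalMaximal_eq_ratMaximal k F)]
  exact (measurable_ratMaximal_param h).comp (measurable_id.prodMk (measurable_pi_apply k))

/-- On almost every line in direction `k` the functions agree almost everywhere, and on such a line
their maximal functions agree at every point. -/
theorem directionalMaximal_congr_ae {n : ℕ} (k : Fin n) {F G : (Fin n → ℝ) → ℝ≥0∞}
    (h : F =ᵐ[volume] G) : directionalMaximal k F =ᵐ[volume] directionalMaximal k G := by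
  cases n with
  | zero => exact k.elim0
  | succ n =>
    have h' := (ae_insertNth_iff k fun x => F x = G x).1 h
    refine (ae_insertNth_iff k fun x => directionalMaximal k F x = directionalMaximal k G x).2 ?_
    have h'' : ∀ᵐ y : Fin n → ℝ, ∀ᵐ s : ℝ, F (k.insertNth (α := fun _ => ℝ) s y) =
        G (k.insertNth (α := fun _ => ℝ) s y) :=
      Measure.ae_ae_of_ae_prod (Measure.measurePreserving_swap.quasiMeasurePreserving.ae h')
    filter_upwards [Measure.quasiMeasurePreserving_snd.ae h''] with z hz
    simp only [directionalMaximal, Fin.update_insertNth]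
    refine iSup_congr fun a => iSup_congr fun b => iSup_congr fun _ => iSup_congr fun _ => ?_
    rw [lintegral_congr_ae (ae_restrict_of_ae hz)]

theorem measurable_foldl_directionalMaximal {n : ℕ} {ι : Type*} (e : ι → Fin n) (l : List ι)
    {F : (Fin n → ℝ) → ℝ≥0∞} (hF : Measurable F) :
    Measurable (l.foldl (fun G i => directionalMaximal (e i) G) F) := by
  induction l generalizing F with
  | nil => exact hF
  | cons i l ih => exact ih (measurable_directionalMaximal (e i) hF)

theorem foldl_directionalMaximal_congr_ae {n : ℕ} (l : List (Fin n)) {F G : (Fin n → ℝ) → ℝ≥0∞}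
    (h : F =ᵐ[volume] G) : l.foldl (fun G k => directionalMaximal k G) F =ᵐ[volume]
      l.foldl (fun G k => directionalMaximal k G) G := by
  induction l generalizing F G with
  | nil => exact h
  | cons k l ih => exact ih (directionalMaximal_congr_ae k h)

theorem measurable_composedMaximal {n : ℕ} {F : (Fin n → ℝ) → ℝ≥0∞} (hF : Measurable F) :
    Measurable (composedMaximal F) := by
  rw [composedMaximal, Fin.foldl_eq_foldl_finRange]
  exact measurable_foldl_directionalMaximal id _ hF

theorem composedMaximal_congr_ae {n : ℕ} {F G : (Fin n → ℝ) → ℝ≥0∞} (h : F =ᵐ[volume] G) :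
    composedMaximal F =ᵐ[volume] composedMaximal G := by
  rw [composedMaximal, composedMaximal, Fin.foldl_eq_foldl_finRange, Fin.foldl_eq_foldl_finRange]
  exact foldl_directionalMaximal_congr_ae _ h

theorem directionalMaximal_castSucc {n : ℕ} (k : Fin n) (F : (Fin (n + 1) → ℝ) → ℝ≥0∞)
    (y : Fin n → ℝ) (s : ℝ) :
    directionalMaximal k.castSucc F (Fin.snoc (α := fun _ => ℝ) y s) =
      directionalMaximal k (fun z => F (Fin.snoc (α := fun _ => ℝ) z s)) y := by
  simp only [directionalMaximal, Fin.snoc_castSucc, Fin.snoc_update]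

theorem foldl_directionalMaximal_castSucc {n : ℕ} (F : (Fin (n + 1) → ℝ) → ℝ≥0∞)
    (y : Fin n → ℝ) (s : ℝ) :
    Fin.foldl n (fun G k => directionalMaximal k.castSucc G) F (Fin.snoc (α := fun _ => ℝ) y s) =
      composedMaximal (fun z => F (Fin.snoc (α := fun _ => ℝ) z s)) y := by
  rw [composedMaximal, Fin.foldl_eq_foldl_finRange, Fin.foldl_eq_foldl_finRange]
  generalize List.finRange n = l
  induction l generalizing F with
  | nil => rfl
  | cons k l ih =>
    rw [List.foldl_cons, List.foldl_cons, ih]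
    simp only [directionalMaximal_castSucc]

/-- The last operator of the fold is the only one that moves the last coordinate; this identity
exposes the vector-valued structure. -/
theorem composedMaximal_snoc {n : ℕ} (F : (Fin (n + 1) → ℝ) → ℝ≥0∞) (y : Fin n → ℝ) (s : ℝ) :
    composedMaximal F (Fin.snoc (α := fun _ => ℝ) y s) = ratMaximal volume
      (fun u => composedMaximal (fun z => F (Fin.snoc (α := fun _ => ℝ) z u)) y) s := by
  rw [composedMaximal, Fin.foldl_succ_last, directionalMaximal_eq_ratMaximal]
  simp only [Fin.update_snoc_last, Fin.snoc_last, foldl_directionalMaximal_castSucc]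

theorem measurable_composedMaximal_snoc {n : ℕ} {F : (Fin (n + 1) → ℝ) → ℝ≥0∞}
    (hF : Measurable F) : Measurable (Function.uncurry fun (y : Fin n → ℝ) (s : ℝ) =>
      composedMaximal (fun z => F (Fin.snoc (α := fun _ => ℝ) z s)) y) := by
  simp only [← foldl_directionalMaximal_castSucc, Fin.foldl_eq_foldl_finRange]
  exact (measurable_foldl_directionalMaximal _ _ hF).comp measurable_snoc

/-! ### Boundedness on mixed Lebesgue spaces -/

/-- The maximal operator on the line, applied to functions with values in a mixed Lebesgue space. -/
theorem exists_weightedBound_mixedNorm {n : ℕ} (q : Fin n → ℝ) (hq : ∀ j, 1 < q j) {r : ℝ}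
    (hr : 1 < r) : ∃ φ : ℝ≥0 → ℝ≥0, ∀ G : (Fin n → ℝ) → ℝ → ℝ≥0∞,
      Measurable (Function.uncurry G) → WeightedBound r φ
        (fun s => mixedNorm q fun y => ratMaximal volume (G y) s)
        (fun s => mixedNorm q fun y => G y s) := by
  induction n generalizing r with
  | zero =>
    choose φ hφ using exists_ratMaximal_weighted hr
    refine ⟨φ, fun G hG K w hw => ?_⟩
    exact hφ K w hw (G Fin.elim0) (hG.comp (measurable_const.prodMk measurable_id))
  | succ n ih =>
    set b := q (Fin.last n) with hb
    have hb1 : 1 < b := hq _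
    have hb0 : b ≠ 0 := by linarith
    obtain ⟨φ, hφ⟩ := ih (fun j => q j.castSucc) (fun j => hq _) hb1
    -- Only the exponent `b` has to be proved: there the outer power 1 / b of the mixed norm
    -- cancels, and Tonelli applies.
    obtain ⟨ψ, hψ⟩ := exists_weightedBound_of_weightedBound hb1 hr φ
    refine ⟨ψ, fun G hG => ?_⟩
    have hMG := measurable_ratMaximal_param hG
    have hswap : ∀ H : (Fin (n + 1) → ℝ) → ℝ → ℝ≥0∞, Measurable (Function.uncurry H) →
        Measurable fun s => mixedNorm q fun y => H y s := fun H hH =>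
      measurable_mixedNorm q (F := fun s y => H y s) (hH.comp measurable_swap)
    refine hψ _ _ (hswap _ hMG) (hswap _ hG) fun K w hw => ?_
    have hslice : ∀ H : (Fin (n + 1) → ℝ) → ℝ → ℝ≥0∞, Measurable (Function.uncurry H) →
        Measurable fun z : ℝ × ℝ => mixedNorm (fun j : Fin n => q j.castSucc) fun y =>
          H (Fin.snoc (α := fun _ => ℝ) y z.2) z.1 := fun H hH =>
      measurable_mixedNorm _
        (F := fun (z : ℝ × ℝ) y => H (Fin.snoc (α := fun _ => ℝ) y z.2) z.1)
        (hH.comp ((measurable_snoc.comp (measurable_snd.prodMk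
          (measurable_snd.comp measurable_fst))).prodMk (measurable_fst.comp measurable_fst)))
    have hfub : ∀ H : (Fin (n + 1) → ℝ) → ℝ → ℝ≥0∞, Measurable (Function.uncurry H) →
        ∫⁻ s, (mixedNorm q fun y => H y s) ^ b * w s =
          ∫⁻ u, ∫⁻ s, (mixedNorm (fun j : Fin n => q j.castSucc) fun y =>
            H (Fin.snoc (α := fun _ => ℝ) y u) s) ^ b * w s := by
      intro H hH
      have hm := hslice H hH
      rw [← lintegral_lintegral_swap
        ((hm.pow_const b).mul (hw.measurable.comp measurable_fst)).aemeasurable]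
      refine lintegral_congr fun s => ?_
      rw [mixedNorm_succ, ← hb, ← ENNReal.rpow_mul, one_div_mul_cancel hb0, ENNReal.rpow_one,
        lintegral_mul_const]
      exact (hm.comp measurable_prodMk_left).pow_const b
    rw [hfub (fun y s => ratMaximal volume (G y) s) hMG, hfub _ hG, ← lintegral_const_mul' _ _ ENNReal.coe_ne_top]
    refine lintegral_mono fun u => ?_
    exact hφ (fun y => G (Fin.snoc (α := fun _ => ℝ) y u))
      (hG.comp ((measurable_snoc.comp (measurable_fst.prodMk measurable_const)).prodMk
        measurable_snd)) K w hw

theorem exists_mixedNorm_composedMaximal_le {n : ℕ} (q : Fin n → ℝ) (hq : ∀ j, 1 < q j) :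
    ∃ C : ℝ≥0, ∀ F : (Fin n → ℝ) → ℝ≥0∞, Measurable F →
      mixedNorm q (composedMaximal F) ≤ C * mixedNorm q F := by
  induction n with
  | zero => exact ⟨1, fun F _ => by simp [composedMaximal]⟩
  | succ n ih =>
    obtain ⟨C, hC⟩ := ih (fun j => q j.castSucc) fun j => hq _
    set b := q (Fin.last n) with hb
    have hb1 : 1 < b := hq _
    have hb0 : 0 < b := by linarith
    obtain ⟨φ, hφ⟩ := exists_weightedBound_mixedNorm (fun j : Fin n => q j.castSucc)
      (fun j => hq _) hb1
    refine ⟨φ 1 ^ (1 / b) * C, fun F hF => ?_⟩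
    -- The vector-valued inequality removes the last operator; the remaining ones act on each slice
    -- and are bounded by the induction hypothesis.
    have h := hφ _ (measurable_composedMaximal_snoc hF) 1 _ (isApWeight_one hb1)
    simp only [mul_one] at h
    rw [mixedNorm_succ, mixedNorm_succ, ← hb]
    simp only [composedMaximal_snoc]
    have hle : ∫⁻ s, (mixedNorm (fun j : Fin n => q j.castSucc) fun y =>
          composedMaximal (fun z => F (Fin.snoc (α := fun _ => ℝ) z s)) y) ^ b ≤
        (C : ℝ≥0∞) ^ b * ∫⁻ s, (mixedNorm (fun j : Fin n => q j.castSucc) fun y =>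
          F (Fin.snoc (α := fun _ => ℝ) y s)) ^ b := by
      rw [← lintegral_const_mul' _ _ (ENNReal.rpow_ne_top_of_nonneg hb0.le ENNReal.coe_ne_top)]
      refine lintegral_mono fun s => ?_
      rw [← ENNReal.mul_rpow_of_nonneg _ _ hb0.le]
      refine ENNReal.rpow_le_rpow (hC _ ?_) hb0.le
      exact hF.comp (measurable_snoc.comp (measurable_id.prodMk measurable_const))
    refine (ENNReal.rpow_le_rpow (h.trans (mul_le_mul_right hle _))
      (one_div_pos.2 hb0).le).trans (le_of_eq ?_)
    rw [ENNReal.mul_rpow_of_nonneg _ _ (one_div_pos.2 hb0).le,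
      ENNReal.mul_rpow_of_nonneg _ _ (one_div_pos.2 hb0).le, ← ENNReal.rpow_mul,
      mul_one_div_cancel hb0.ne', ENNReal.rpow_one, ENNReal.coe_mul,
      ENNReal.coe_rpow_of_nonneg _ (one_div_pos.2 hb0).le, mul_assoc]

theorem theorem1 (n : ℕ) (p : Fin n → ℝ) (hp : ∀ j, 0 < p j)
    (t : ℝ) (ht : 0 < t) (htp : ∀ j, t < p j) :
    ∃ C : ℝ≥0, 0 < C ∧ ∀ f ∈ mixedLebesgue p,
      AEMeasurable (iteratedMaximal t f) volume ∧
      mixedNorm p (iteratedMaximal t f) ≤ C * mixedNorm p (fun x => ‖f x‖ₑ) := by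
  obtain ⟨C, hC⟩ := exists_mixedNorm_composedMaximal_le (fun j => p j / t)
    fun j => (one_lt_div ht).2 (htp j)
  refine ⟨C ^ (1 / t) + 1, by positivity, fun f hf => ?_⟩
  have hF : AEMeasurable (fun y => ‖f y‖ₑ ^ t) volume := hf.1.enorm.pow_const t
  have hFg := hF.ae_eq_mk
  -- The Borel representative keeps every iterated integral measurable; almost-everywhere invariance
  -- carries the result back to `f`.
  set g := hF.mk (fun y => ‖f y‖ₑ ^ t)
  have hg : Measurable g := hF.measurable_mk
  have hae : iteratedMaximal t f =ᵐ[volume] fun x => composedMaximal g x ^ (1 / t) := by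
    filter_upwards [composedMaximal_congr_ae hFg] with x hx
    rw [iteratedMaximal, hx]
  refine ⟨⟨_, (measurable_composedMaximal hg).pow_const _, hae⟩, ?_⟩
  have hfg : (fun x => ‖f x‖ₑ) =ᵐ[volume] fun x => g x ^ (1 / t) := by
    filter_upwards [hFg] with x hx
    rw [← hx, ← ENNReal.rpow_mul, mul_one_div_cancel ht.ne', ENNReal.rpow_one]
  rw [mixedNorm_congr_ae p hae, mixedNorm_congr_ae p hfg, mixedNorm_rpow p ht, mixedNorm_rpow p ht]
  refine (ENNReal.rpow_le_rpow (hC g hg) (one_div_pos.2 ht).le).trans ?_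
  rw [ENNReal.mul_rpow_of_nonneg _ _ (one_div_pos.2 ht).le, ENNReal.coe_add,
    ENNReal.coe_rpow_of_nonneg _ (one_div_pos.2 ht).le]
  gcongr
  exact le_self_add
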